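/- Let $N=3$, let $A=(-\mathrm{i}\partial_x)^3$ in $L^2(\mathbb{R},\mathbb{C})$ with domain $H^3(\mathbb{R},\mathbb{C})$, and let $V$ be the operator of multiplication by a continuous compactly supported function $V:\mathbb{R}\to\mathbb{C}$. For $s\in\mathbb{R}$ let $L^2_s(\mathbb{R},\mathbb{C})=\{f\in L^2_{\mathrm{loc}}:\ \langle x\rangle^s f\in L^2\}$ with norm $\|f\|_{L^2_s}=\|\langle x\rangle^s f\|_{L^2}$, where $\langle x\rangle=(1+x^2)^{1/2}$, and let $\mathbb{C}_+=\{z\in\mathbb{C}:\ \operatorname{Im} z>0\}$. Let $s,s'>N-\tfrac32=\tfrac32$. Then exactly one of the following two alternatives holds: (1) there is $\delta>0$ such that the resolvent $(A+V-zI)^{-1}$ (a bounded operator in $L^2(\mathbb{R},\mathbb{C})$) exists for all $z\in\mathbb{C}_+$ with $|z|<\delta$, and, considered as a mapping $L^2_s(\mathbb{R},\mathbb{C})\to L^2_{-s'}(\mathbb{R},\mathbb{C})$, it converges in the operator norm of $\mathscr{B}(L^2_s,L^2_{-s'})$ as $z\to 0$, $z\in\mathbb{C}_+$; (2) there is a solution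 $\Psi\in C^3(\mathbb{R},\mathbb{C})$, $\Psi\not\equiv 0$, to $\big((-\mathrm{i}\partial_x)^3+V\big)\Psi=0$ on $\mathbb{R}$ such that $\langle x\rangle^{-1}\Psi$ is bounded on $\mathbb{R}$ and $\Psi$ is bounded on $(-\infty,0]$. -/

import Mathlib

open MeasureTheory Filter Topology
open scoped ENNReal SchwartzMap LineDeriv

namespace CubicOperator

noncomputable section

/-- The Japanese bracket `⟨x⟩ = (1 + x²)^{1/2}`. -/
def bracket (x : ℝ) : ℝ := Real.sqrt (1 + x ^ 2)

lemma one_le_bracket (x : ℝ) : 1 ≤ bracket x := by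
  rw [bracket, Real.one_le_sqrt]
  nlinarith [sq_nonneg x]

/-! ### Weighted spaces -/

/-- The measure `⟨x⟩^{2s} dx` on the real line. -/
def weight (s : ℝ) : Measure ℝ :=
  volume.withDensity fun x => ENNReal.ofReal (bracket x ^ (2 * s))

/-- The Hilbert space `L²(ℝ, ℂ)`. -/
abbrev L2 : Type := Lp ℂ 2 (volume : Measure ℝ)

/-- The weighted space `L²_s(ℝ, ℂ)`, with norm `‖f‖ = ‖⟨x⟩^s f‖_{L²}`. -/
abbrev L2w (s : ℝ) : Type := Lp ℂ 2 (weight s)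

lemma volume_le_weight {s : ℝ} (hs : 0 ≤ s) : (volume : Measure ℝ) ≤ weight s := by
  calc (volume : Measure ℝ) = volume.withDensity 1 := withDensity_one.symm
    _ ≤ weight s := by
      refine withDensity_mono (Eventually.of_forall fun x => ?_)
      simpa using Real.one_le_rpow (one_le_bracket x) (by linarith : 0 ≤ 2 * s)

lemma weight_le_volume {s : ℝ} (hs : s ≤ 0) : weight s ≤ (volume : Measure ℝ) := by
  calc weight s ≤ volume.withDensity 1 := by
        refine withDensity_mono (Eventually.of_forall fun x => ?_)
        simpa using Real.rpow_le_one_of_one_le_of_nonpos (one_le_bracket x)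
          (by linarith : 2 * s ≤ 0)
    _ = volume := withDensity_one

/-- The inclusion `L²(ν) → L²(μ)`, `f ↦ f`, for measures `μ ≤ ν`. -/
def inclusion {μ ν : Measure ℝ} (h : μ ≤ ν) : Lp ℂ 2 ν →L[ℂ] Lp ℂ 2 μ :=
  LinearMap.mkContinuous
    { toFun := fun f => ((Lp.memLp f).mono_measure h).toLp f
      map_add' := fun f g => by
        rw [← MemLp.toLp_add]
        exact MemLp.toLp_congr _ _
          ((Measure.absolutelyContinuous_of_le h).ae_le (Lp.coeFn_add f g))
      map_smul' := fun c f => by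
        rw [RingHom.id_apply, ← MemLp.toLp_const_smul]
        exact MemLp.toLp_congr _ _
          ((Measure.absolutelyContinuous_of_le h).ae_le (Lp.coeFn_smul c f)) }
    1 fun f => by
      rw [one_mul, LinearMap.coe_mk, AddHom.coe_mk, Lp.norm_toLp, Lp.norm_def]
      exact ENNReal.toReal_mono (Lp.eLpNorm_ne_top f) (eLpNorm_mono_measure _ h)

/-- The embedding `L²_s → L²`, `s ≥ 0`. -/
def embIn {s : ℝ} (hs : 0 ≤ s) : L2w s →L[ℂ] L2 := inclusion (volume_le_weight hs)

/-- The embedding `L² → L²_{-s}`, `s ≥ 0`. -/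
def embOut {s : ℝ} (hs : 0 ≤ s) : L2 →L[ℂ] L2w (-s) :=
  inclusion (weight_le_volume (neg_nonpos.mpr hs))

/-! ### The operators -/

/-- The operator `-i ∂ₓ` on tempered distributions. -/
def momentum : 𝓢'(ℝ, ℂ) →ₗ[ℂ] 𝓢'(ℝ, ℂ) where
  toFun u := (-Complex.I) • ∂_{(1 : ℝ)} u
  map_add' u v := by rw [LineDeriv.lineDerivOp_add, smul_add]
  map_smul' c u := by
    rw [LineDeriv.lineDerivOp_smul, RingHom.id_apply, smul_comm]

/-- The inclusion of `L²(ℝ, ℂ)` into the tempered distributions. -/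
def toDist : L2 →ₗ[ℂ] 𝓢'(ℝ, ℂ) := (Lp.toTemperedDistributionCLM ℂ (volume : Measure ℝ) 2 : _ →ₗ[ℂ] _)

lemma toDist_injective : Function.Injective toDist :=
  LinearMap.ker_eq_bot.mp
    (Lp.ker_toTemperedDistributionCLM_eq_bot (μ := (volume : Measure ℝ)) (F := ℂ) (p := 2))

/-- The Sobolev space `H³(ℝ, ℂ)` as a subspace of `L²(ℝ, ℂ)`. -/
def H3 : Submodule ℂ L2 where
  carrier := {u | TemperedDistribution.MemSobolev 3 2 (toDist u)}
  zero_mem' := by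
    show TemperedDistribution.MemSobolev 3 2 (toDist 0)
    rw [map_zero]
    exact TemperedDistribution.memSobolev_fun_zero (E := ℝ) (F := ℂ) 3 2
  add_mem' {u v} hu hv := by
    show TemperedDistribution.MemSobolev 3 2 (toDist (u + v))
    rw [map_add]
    exact TemperedDistribution.MemSobolev.add hu hv
  smul_mem' c u hu := by
    show TemperedDistribution.MemSobolev 3 2 (toDist (c • u))
    rw [map_smul]
    exact TemperedDistribution.MemSobolev.smul c hu

/-- On `H³` the distribution `(-i∂ₓ)³ u` is a function in `L²`. -/
lemma exists_momentum_cube (u : H3) : ∃ v : L2, toDist v = (momentum ^ 3) (toDist u) := by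
  have key : ∀ (r : ℝ) (w : 𝓢'(ℝ, ℂ)), TemperedDistribution.MemSobolev r 2 w →
      TemperedDistribution.MemSobolev (r - 1) 2 (momentum w) := fun r w hw =>
    (hw.lineDerivOp (m := (1 : ℝ))).smul (-Complex.I)
  have h := key _ _ (key _ _ (key _ _ u.2))
  norm_num at h
  obtain ⟨v, hv⟩ := TemperedDistribution.memSobolev_zero_iff.mp h
  exact ⟨v, hv.symm⟩

/-- The operator `A = (-i∂ₓ)³` in `L²(ℝ, ℂ)` with domain `H³(ℝ, ℂ)`. -/
def A : L2 →ₗ.[ℂ] L2 where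
  domain := H3
  toFun :=
    { toFun := fun u => (exists_momentum_cube u).choose
      map_add' := fun u v => toDist_injective <| by
        rw [map_add, (exists_momentum_cube u).choose_spec, (exists_momentum_cube v).choose_spec,
          (exists_momentum_cube (u + v)).choose_spec, Submodule.coe_add, map_add, map_add]
      map_smul' := fun c u => toDist_injective <| by
        rw [RingHom.id_apply, map_smul, (exists_momentum_cube u).choose_spec,
          (exists_momentum_cube (c • u)).choose_spec, Submodule.coe_smul, map_smul, map_smul] }

lemma memLp_potential (V : ℝ → ℂ) (hV : Continuous V) (hc : HasCompactSupport V) :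
    MemLp V ∞ (volume : Measure ℝ) :=
  hV.memLp_of_hasCompactSupport hc

/-- The bounded operator of multiplication by `V` in `L²(ℝ, ℂ)`, where `V` is continuous
and compactly supported. -/
def mulOp (V : ℝ → ℂ) (hV : Continuous V) (hc : HasCompactSupport V) : L2 →L[ℂ] L2 :=
  (ContinuousLinearMap.mul ℂ ℂ).holderL volume ∞ 2 2 ((memLp_potential V hV hc).toLp V)

/-- The operator `A + V` in `L²(ℝ, ℂ)`, with domain `H³(ℝ, ℂ)`. -/
def perturbed (V : ℝ → ℂ) (hV : Continuous V) (hc : HasCompactSupport V) : L2 →ₗ.[ℂ] L2 :=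
  (mulOp V hV hc : L2 →ₗ[ℂ] L2) +ᵥ A

/-- `R` is the resolvent `(T - z)⁻¹`: a bounded operator on `L²` which is a two-sided inverse of
`T - z : D(T) → L²`. -/
def IsResolvent (T : L2 →ₗ.[ℂ] L2) (z : ℂ) (R : L2 →L[ℂ] L2) : Prop :=
  (∀ f : L2, ∃ h : R f ∈ T.domain, T ⟨R f, h⟩ - z • R f = f) ∧
  ∀ u : T.domain, R (T u - z • (u : L2)) = u

/-- The limiting absorption principle at `z₀ = 0` relative to `L²_s`, `L²_{-s'}` and the open upper
half-plane `ℂ₊`: the resolvent `(T - z)⁻¹` exists for `z ∈ ℂ₊` near `0`, and it converges in the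
operator norm of `B(L²_s, L²_{-s'})` as `z → 0`, `z ∈ ℂ₊`. -/
def ResolventConverges (T : L2 →ₗ.[ℂ] L2) {s s' : ℝ} (hs : 0 ≤ s) (hs' : 0 ≤ s') : Prop :=
  ∃ R : ℂ → L2 →L[ℂ] L2,
    (∀ᶠ z in 𝓝[{z : ℂ | 0 < z.im}] 0, IsResolvent T z (R z)) ∧
    ∃ R₀ : L2w s →L[ℂ] L2w (-s'),
      Tendsto (fun z => embOut hs' ∘L R z ∘L embIn hs) (𝓝[{z : ℂ | 0 < z.im}] 0) (𝓝 R₀)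

/-- `Ψ` is a solution of `((-i∂ₓ)³ + V) Ψ = 0` on the real line. -/
def IsSolution (V Ψ : ℝ → ℂ) : Prop :=
  ContDiff ℝ 3 Ψ ∧ ∀ x : ℝ, (-Complex.I) ^ 3 * iteratedDeriv 3 Ψ x + V x * Ψ x = 0

end

end CubicOperator

namespace CubicOperator

/-! ### Dominated convergence in `L²` and Hilbert–Schmidt operators -/

section HilbertSchmidt

variable {α β : Type*} [MeasurableSpace α] [MeasurableSpace β]

/-! For Im z > 0 put λ = `root z`, so that λ³ = -iz and λ → 0 as z → 0. The free resolvent (A - z)⁻¹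
is convolution with κ·`prof λ`, where κ = i/(3λ²) blows up (`freeRes_ae_eq`). Since `prof λ` = 1 +
λt + O(λ²), splitting off the rank-one kernel κ·prof(x)·prof(-y) removes the whole singularity: the
remainder is bounded by 2|x||y| uniformly in λ and converges pointwise (`norm_regKer_le`,
`tendsto_regKer`). The weights s, s' > 3/2 are what makes |x||y| a Hilbert–Schmidt majorant from
L²_s to L²_{-s'}, so the remainder G_z converges in operator norm to a compact G₀ (`tendsto_regOp`,
`isCompactOperator_limOp`).

Thus the weighted free resolvent is G_z + κ q_z ⊗ p_z with κ → ∞, p_z → 1 and q_z → ∫. Inverting 1 +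
(G_z + κ q_z ⊗ p_z)V becomes a regular problem after adjoining the unknown c = -κ q_z(Vu): the block
operator (u, c) ↦ (u + G_z V u - c p_z, q_z(Vu) + κ⁻¹c) has a norm limit, which is identity plus
compact. If the limit is injective, it is invertible and the perturbed resolvent converges
(`exists_tendsto_resolvent`). If its kernel contains (u, c) with u ≠ 0, convergence is impossible
(`eq_zero_of_tendsto_resolvent`): inputs are built whose free resolvents tend to u, while the
perturbed resolvent reproduces them from data tending to 0.

A null vector of the limit satisfies ∫Vu = 0 and u = c - G₀Vu. Under the first condition G₀ reduces
to convolution with the fundamental solution of (-i∂)³ up to a constant, so u is a constant plus the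
threefold primitive of iVu (`blockOp_eq_zero_iff`). Such a u is a solution constant to the left of
the support of V; to its right it is a quadratic polynomial whose leading coefficient is a multiple
of ∫Vu = 0. This is exactly the growth in the second alternative, and conversely that growth forces
this form (`eq_const_add_prim3`, `isSolution_of_eq_const_add_prim3`). -/

lemma eLpNorm_two_sq {μ : Measure α} (f : α → ℂ) :
    eLpNorm f 2 μ ^ 2 = ∫⁻ x, ‖f x‖ₑ ^ 2 ∂μ := by
  have := eLpNorm_nnreal_pow_eq_lintegral (μ := μ) (f := f) (p := 2) two_ne_zero
  simpa using this

lemma tendsto_eLpNorm_sub_of_dominated {μ : Measure α} {ι : Type*} {l : Filter ι}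
    [l.IsCountablyGenerated] {F : ι → α → ℂ} {f : α → ℂ} {B : α → ℝ}
    (hF : ∀ i, Measurable (F i)) (hf : Measurable f)
    (hB : MemLp B 2 μ) (hFB : ∀ᶠ i in l, ∀ x, ‖F i x‖ ≤ B x) (hfB : ∀ x, ‖f x‖ ≤ B x)
    (hlim : ∀ x, Tendsto (fun i => F i x) l (𝓝 (f x))) :
    Tendsto (fun i => eLpNorm (F i - f) 2 μ) l (𝓝 0) := by
  have h1 : Tendsto (fun i => ∫⁻ x, ‖(F i - f) x‖ₑ ^ 2 ∂μ) l (𝓝 (∫⁻ _, 0 ∂μ)) := by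
    refine tendsto_lintegral_filter_of_dominated_convergence
      (fun x => ‖(2 * B x : ℝ)‖ₑ ^ 2) ?_ ?_ ?_ ?_
    · exact Eventually.of_forall fun i => ((hF i).sub hf).enorm.pow_const 2
    · filter_upwards [hFB] with i hi
      refine Eventually.of_forall fun x => ?_
      gcongr
      rw [Pi.sub_apply]
      refine enorm_le_iff_norm_le.mpr ?_
      have := norm_nonneg (f x)
      rw [Real.norm_eq_abs, abs_of_nonneg (by linarith [hfB x])]
      linarith [norm_sub_le (F i x) (f x), hi x, hfB x]
    · have h2 : MemLp (fun x => 2 * B x) 2 μ := hB.const_mul 2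
      have := eLpNorm_nnreal_pow_eq_lintegral (μ := μ) (f := fun x => 2 * B x) (p := 2) two_ne_zero
      simp only [ENNReal.coe_ofNat, NNReal.coe_ofNat, ENNReal.rpow_ofNat] at this
      rw [← this]
      exact ENNReal.pow_ne_top h2.2.ne
    · refine Eventually.of_forall fun x => ?_
      have h3 : Tendsto (fun i => (F i - f) x) l (𝓝 0) := by
        simpa using (hlim x).sub_const (f x)
      have h4 := ((continuous_enorm.tendsto (0 : ℂ)).comp h3)
      simpa using ENNReal.Tendsto.pow (n := 2) h4
  rw [lintegral_zero] at h1
  have h2 := (ENNReal.continuous_rpow_const (y := (2 : ℝ)⁻¹)).tendsto 0 |>.comp h1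
  rw [ENNReal.zero_rpow_of_pos (by norm_num)] at h2
  refine h2.congr fun i => ?_
  simp only [Function.comp_apply]
  rw [← eLpNorm_two_sq, ← ENNReal.rpow_natCast, ← ENNReal.rpow_mul]
  norm_num

lemma tendsto_toLp_of_dominated {μ : Measure α} {ι : Type*} {l : Filter ι}
    [l.IsCountablyGenerated] {F : ι → α → ℂ} {f : α → ℂ} {B : α → ℝ}
    (mF : ∀ i, Measurable (F i)) (mf : Measurable f)
    (hF : ∀ i, MemLp (F i) 2 μ) (hf : MemLp f 2 μ)
    (hB : MemLp B 2 μ) (hFB : ∀ᶠ i in l, ∀ x, ‖F i x‖ ≤ B x) (hfB : ∀ x, ‖f x‖ ≤ B x)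
    (hlim : ∀ x, Tendsto (fun i => F i x) l (𝓝 (f x))) :
    Tendsto (fun i => (hF i).toLp (F i)) l (𝓝 (hf.toLp f)) :=
  (Lp.tendsto_Lp_iff_tendsto_eLpNorm'' _ hF _ hf).mpr
    (tendsto_eLpNorm_sub_of_dominated mF mf hB hFB hfB hlim)

lemma MemLp.mul_prod {μ : Measure α} {ν : Measure β} [SFinite μ] [SFinite ν] {a : α → ℝ} {b : β → ℝ}
    (ha : MemLp a 2 μ) (hb : MemLp b 2 ν) : MemLp (fun x : α × β => a x.1 * b x.2) 2 (μ.prod ν) := by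
  have hm : AEStronglyMeasurable (fun x : α × β => a x.1 * b x.2) (μ.prod ν) :=
    ha.1.comp_fst.mul hb.1.comp_snd
  rw [memLp_two_iff_integrable_sq hm]
  have := ((memLp_two_iff_integrable_sq ha.1).mp ha).mul_prod ((memLp_two_iff_integrable_sq hb.1).mp hb)
  refine this.congr (Eventually.of_forall fun x => ?_)
  simp only
  ring

lemma lintegral_mul_sq_le {μ : Measure α} {f g : α → ℂ} (hf : AEStronglyMeasurable f μ)
    (hg : AEStronglyMeasurable g μ) :
    (∫⁻ x, ‖f x * g x‖ₑ ∂μ) ^ 2 ≤ (∫⁻ x, ‖f x‖ₑ ^ 2 ∂μ) * ∫⁻ x, ‖g x‖ₑ ^ 2 ∂μ := by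
  have h := ENNReal.lintegral_mul_le_Lp_mul_Lq μ (Real.HolderConjugate.two_two) hf.enorm hg.enorm
  have e : ∀ a : ℝ≥0∞, (a ^ (1 / 2 : ℝ)) ^ 2 = a := fun a => by
    rw [← ENNReal.rpow_natCast, ← ENNReal.rpow_mul]; norm_num
  calc (∫⁻ x, ‖f x * g x‖ₑ ∂μ) ^ 2
      ≤ ((∫⁻ x, ‖f x‖ₑ ^ (2 : ℝ) ∂μ) ^ (1 / 2 : ℝ) *
          (∫⁻ x, ‖g x‖ₑ ^ (2 : ℝ) ∂μ) ^ (1 / 2 : ℝ)) ^ 2 := by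
        gcongr
        simpa using h
    _ = _ := by
        rw [mul_pow, e, e]
        simp

variable {μ : Measure α} {ν : Measure β} [SFinite μ]

/-- Cauchy–Schwarz in y for almost every x, then Tonelli: the Hilbert–Schmidt norm bounds the
operator norm. -/
lemma eLpNorm_kernel_le {K : β × α → ℂ} (hK : AEStronglyMeasurable K (ν.prod μ)) {f : α → ℂ}
    (hf : AEStronglyMeasurable f μ) :
    eLpNorm (fun x => ∫ y, K (x, y) * f y ∂μ) 2 ν ≤ eLpNorm K 2 (ν.prod μ) * eLpNorm f 2 μ := by
  rw [← ENNReal.pow_le_pow_left_iff two_ne_zero, mul_pow]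
  simp only [eLpNorm_two_sq]
  rw [lintegral_prod _ (hK.enorm.pow_const 2)]
  have h1 : AEMeasurable (fun x => ∫⁻ y, ‖K (x, y)‖ₑ ^ 2 ∂μ) ν :=
    (hK.enorm.pow_const 2).lintegral_prod_right'
  rw [← lintegral_mul_const'' _ h1]
  refine lintegral_mono_ae ?_
  filter_upwards [hK.prodMk_left] with x hx
  calc ‖∫ y, K (x, y) * f y ∂μ‖ₑ ^ 2 ≤ (∫⁻ y, ‖K (x, y) * f y‖ₑ ∂μ) ^ 2 := by
        gcongr
        exact enorm_integral_le_lintegral_enorm _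
    _ ≤ _ := lintegral_mul_sq_le hx hf

lemma memLp_kernel {K : β × α → ℂ} (hK : MemLp K 2 (ν.prod μ)) {f : α → ℂ}
    (hf : MemLp f 2 μ) : MemLp (fun x => ∫ y, K (x, y) * f y ∂μ) 2 ν := by
  refine ⟨?_, (eLpNorm_kernel_le hK.1 hf.1).trans_lt (ENNReal.mul_lt_top hK.2 hf.2)⟩
  exact (hK.1.mul hf.1.comp_snd).integral_prod_right'

lemma integrable_kernel {K : β × α → ℂ} (hK : MemLp K 2 (ν.prod μ)) {f : α → ℂ}
    (hf : MemLp f 2 μ) : ∀ᵐ x ∂ν, Integrable (fun y => K (x, y) * f y) μ := by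
  have h1 : ∫⁻ x, ∫⁻ y, ‖K (x, y)‖ₑ ^ 2 ∂μ ∂ν ≠ ∞ := by
    rw [← lintegral_prod (fun a => ‖K a‖ₑ ^ 2) (hK.1.enorm.pow_const 2), ← eLpNorm_two_sq]
    exact ENNReal.pow_ne_top hK.2.ne
  filter_upwards [hK.1.prodMk_left,
    ae_lt_top' (hK.1.enorm.pow_const 2).lintegral_prod_right' h1] with x hx hx'
  have : MemLp (fun y => K (x, y)) 2 μ := by
    refine ⟨hx, ?_⟩
    have : eLpNorm (fun y => K (x, y)) 2 μ ^ 2 < ∞ := by rwa [eLpNorm_two_sq]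
    exact (ENNReal.pow_lt_top_iff.mp this).resolve_right two_ne_zero
  exact this.integrable_mul hf

noncomputable section

/-- The Hilbert–Schmidt operator `f ↦ ∫ K(·, y) f(y) dμ(y)` with a square integrable kernel. -/
def hsOp (K : β × α → ℂ) (hK : MemLp K 2 (ν.prod μ)) : Lp ℂ 2 μ →L[ℂ] Lp ℂ 2 ν :=
  LinearMap.mkContinuous
    { toFun := fun f => (memLp_kernel hK (Lp.memLp f)).toLp _
      map_add' := fun f g => by
        rw [← MemLp.toLp_add]
        refine MemLp.toLp_congr _ _ ?_
        filter_upwards [integrable_kernel hK (Lp.memLp f), integrable_kernel hK (Lp.memLp g)]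
          with x h1 h2
        rw [Pi.add_apply, ← integral_add h1 h2]
        refine integral_congr_ae ?_
        filter_upwards [Lp.coeFn_add f g] with y hy
        rw [hy, Pi.add_apply, mul_add]
      map_smul' := fun c f => by
        rw [RingHom.id_apply, ← MemLp.toLp_const_smul]
        refine MemLp.toLp_congr _ _ (Eventually.of_forall fun x => ?_)
        simp only [Pi.smul_apply, smul_eq_mul]
        rw [← integral_const_mul]
        refine integral_congr_ae ?_
        filter_upwards [Lp.coeFn_smul c f] with y hy
        rw [hy, Pi.smul_apply, smul_eq_mul]
        ring }
    (eLpNorm K 2 (ν.prod μ)).toReal fun f => by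
      rw [LinearMap.coe_mk, AddHom.coe_mk, Lp.norm_toLp, Lp.norm_def, ← ENNReal.toReal_mul]
      exact ENNReal.toReal_mono (ENNReal.mul_ne_top hK.2.ne (Lp.eLpNorm_ne_top f))
        (eLpNorm_kernel_le hK.1 (Lp.memLp f).1)

lemma hsOp_coeFn (K : β × α → ℂ) (hK : MemLp K 2 (ν.prod μ)) (f : Lp ℂ 2 μ) :
    hsOp K hK f =ᵐ[ν] fun x => ∫ y, K (x, y) * f y ∂μ :=
  (memLp_kernel hK (Lp.memLp f)).coeFn_toLp

lemma norm_hsOp_le (K : β × α → ℂ) (hK : MemLp K 2 (ν.prod μ)) :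
    ‖hsOp K hK‖ ≤ (eLpNorm K 2 (ν.prod μ)).toReal :=
  LinearMap.mkContinuous_norm_le _ ENNReal.toReal_nonneg _

lemma hsOp_sub (K L : β × α → ℂ) (hK : MemLp K 2 (ν.prod μ)) (hL : MemLp L 2 (ν.prod μ)) :
    hsOp K hK - hsOp L hL = hsOp (K - L) (hK.sub hL) := by
  refine ContinuousLinearMap.ext fun f => Lp.ext ?_
  rw [sub_apply]
  filter_upwards [Lp.coeFn_sub (hsOp K hK f) (hsOp L hL f), hsOp_coeFn K hK f, hsOp_coeFn L hL f,
    hsOp_coeFn _ (hK.sub hL) f, integrable_kernel hK (Lp.memLp f),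
    integrable_kernel hL (Lp.memLp f)] with x h1 h2 h3 h4 h5 h6
  rw [h1, Pi.sub_apply, h2, h3, h4, ← integral_sub h5 h6]
  simp only [Pi.sub_apply, sub_mul]

lemma hsOp_add (K L : β × α → ℂ) (hK : MemLp K 2 (ν.prod μ)) (hL : MemLp L 2 (ν.prod μ)) :
    hsOp (K + L) (hK.add hL) = hsOp K hK + hsOp L hL := by
  rw [← sub_eq_iff_eq_add, hsOp_sub]
  congr 1
  simp

/-- Pointwise convergence of kernels under a square integrable majorant is convergence in
Hilbert–Schmidt norm, hence in operator norm. -/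
lemma tendsto_hsOp_of_dominated {ι : Type*} {l : Filter ι}
    [l.IsCountablyGenerated] {F : ι → β × α → ℂ} {f : β × α → ℂ} {B : β × α → ℝ}
    (mF : ∀ i, Measurable (F i)) (mf : Measurable f)
    (hF : ∀ i, MemLp (F i) 2 (ν.prod μ)) (hf : MemLp f 2 (ν.prod μ))
    (hB : MemLp B 2 (ν.prod μ)) (hFB : ∀ᶠ i in l, ∀ x, ‖F i x‖ ≤ B x) (hfB : ∀ x, ‖f x‖ ≤ B x)
    (hlim : ∀ x, Tendsto (fun i => F i x) l (𝓝 (f x))) :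
    Tendsto (fun i => hsOp (F i) (hF i)) l (𝓝 (hsOp f hf)) := by
  rw [tendsto_iff_norm_sub_tendsto_zero]
  have h := (ENNReal.tendsto_toReal ENNReal.zero_ne_top).comp (tendsto_eLpNorm_sub_of_dominated
    mF mf hB hFB hfB hlim)
  refine squeeze_zero (fun _ => norm_nonneg _) (fun i => ?_) h
  rw [hsOp_sub]
  exact norm_hsOp_le _ _

/-- A product kernel factors through ℂ: pair bilinearly with b, then multiply a by the resulting
scalar. -/
lemma isCompactOperator_hsOp_mul {a : β → ℂ} {b : α → ℂ} (hb : MemLp b 2 μ)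
    (ha : MemLp a 2 ν) (h : MemLp (fun x : β × α => a x.1 * b x.2) 2 (ν.prod μ)) :
    IsCompactOperator (hsOp _ h) := by
  have e : hsOp _ h = ContinuousLinearMap.toSpanSingleton ℂ (ha.toLp a) ∘L
      (ContinuousLinearMap.mul ℂ ℂ).lpPairing μ 2 2 (hb.toLp b) := by
    refine ContinuousLinearMap.ext fun f => Lp.ext ?_
    rw [ContinuousLinearMap.comp_apply, ContinuousLinearMap.toSpanSingleton_apply]
    filter_upwards [hsOp_coeFn _ h f, ha.coeFn_toLp, Lp.coeFn_smul
      ((ContinuousLinearMap.mul ℂ ℂ).lpPairing μ 2 2 (hb.toLp b) f) (ha.toLp a)] with x h1 h2 h3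
    rw [h1, h3, Pi.smul_apply, h2, ContinuousLinearMap.lpPairing_eq_integral]
    simp only [mul_assoc]
    rw [integral_const_mul, smul_eq_mul, mul_comm]
    congr 1
    refine integral_congr_ae ?_
    filter_upwards [hb.coeFn_toLp] with y hy
    simp [hy]
  rw [e]
  exact (isCompactOperator_of_locallyCompactSpace_dom
    ((ContinuousLinearMap.mul ℂ ℂ).lpPairing μ 2 2 (hb.toLp b))).clm_comp
    (ContinuousLinearMap.toSpanSingleton ℂ (ha.toLp a))

end

end HilbertSchmidt

/-! ### The weighted measures -/

section Weight

lemma bracket_pos (x : ℝ) : 0 < bracket x := one_pos.trans_le (one_le_bracket x)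

lemma continuous_bracket : Continuous bracket :=
  Real.continuous_sqrt.comp (continuous_const.add (continuous_pow 2))

lemma abs_le_bracket (x : ℝ) : |x| ≤ bracket x :=
  Real.abs_le_sqrt (by linarith)

lemma continuous_bracket_rpow (r : ℝ) : Continuous fun x => bracket x ^ r :=
  continuous_bracket.rpow_const fun x => Or.inl (bracket_pos x).ne'

lemma measurable_weight_density (s : ℝ) :
    Measurable fun x => ENNReal.ofReal (bracket x ^ (2 * s)) :=
  ENNReal.measurable_ofReal.comp (continuous_bracket_rpow _).measurable

instance (s : ℝ) : SFinite (weight s) := by unfold weight; infer_instance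

/-- The density is positive, so all weighted spaces share the Lebesgue null sets; elements of
different spaces can then be compared almost everywhere. -/
lemma ae_weight (s : ℝ) : ae (weight s) = ae (volume : Measure ℝ) := by
  refine le_antisymm (withDensity_absolutelyContinuous _ _).ae_le
    (withDensity_absolutelyContinuous' (measurable_weight_density s).aemeasurable
      (Eventually.of_forall fun x => ?_)).ae_le
  simpa using Real.rpow_pos_of_pos (bracket_pos x) _

lemma aestronglyMeasurable_weight {s t : ℝ} {f : ℝ → ℂ} (hf : AEStronglyMeasurable f (weight s)) :
    AEStronglyMeasurable f (weight t) := by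
  refine hf.mono_ac ?_
  rw [← Measure.ae_le_iff_absolutelyContinuous, ae_weight, ae_weight]

lemma lintegral_weight (s : ℝ) (f : ℝ → ℝ≥0∞) :
    ∫⁻ x, f x ∂weight s = ∫⁻ x, ENNReal.ofReal (bracket x ^ (2 * s)) * f x := by
  rw [weight, lintegral_withDensity_eq_lintegral_mul_non_measurable _ (measurable_weight_density s)
    (Eventually.of_forall fun x => ENNReal.ofReal_lt_top)]
  rfl

lemma integral_weight (s : ℝ) (f : ℝ → ℂ) :
    ∫ x, f x ∂weight s = ∫ x, ((bracket x ^ (2 * s) : ℝ) : ℂ) * f x := by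
  rw [weight, integral_withDensity_eq_integral_toReal_smul (measurable_weight_density s)
    (Eventually.of_forall fun x => ENNReal.ofReal_lt_top)]
  refine integral_congr_ae (Eventually.of_forall fun x => ?_)
  simp only
  rw [ENNReal.toReal_ofReal (Real.rpow_nonneg (bracket_pos x).le _), Complex.real_smul]

lemma integrable_weight_iff (s : ℝ) (f : ℝ → ℂ) :
    Integrable f (weight s) ↔ Integrable fun x => ((bracket x ^ (2 * s) : ℝ) : ℂ) * f x := by
  rw [weight, integrable_withDensity_iff_integrable_smul' (measurable_weight_density s)
    (Eventually.of_forall fun x => ENNReal.ofReal_lt_top)]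
  refine integrable_congr (Eventually.of_forall fun x => ?_)
  simp only
  rw [ENNReal.toReal_ofReal (Real.rpow_nonneg (bracket_pos x).le _), Complex.real_smul]

/-- Integrability of ⟨x⟩^{2r+2t}. The case r = 1, t = -s' is the source of the threshold s' > 3/2.
-/
lemma memLp_bracket_rpow {r t : ℝ} (h : 2 * r + 2 * t < -1) :
    MemLp (fun x => bracket x ^ r) 2 (weight t) := by
  have hm : AEStronglyMeasurable (fun x => bracket x ^ r) (weight t) :=
    (continuous_bracket_rpow r).aestronglyMeasurable
  rw [memLp_two_iff_integrable_sq hm, weight, integrable_withDensity_iff_integrable_smul'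
    (measurable_weight_density t) (Eventually.of_forall fun x => ENNReal.ofReal_lt_top)]
  have h1 : Integrable (fun x : ℝ => (1 + ‖x‖ ^ 2) ^ (-(-(2 * r + 2 * t)) / 2)) volume :=
    integrable_rpow_neg_one_add_norm_sq (by simpa using by linarith)
  refine h1.congr (Eventually.of_forall fun x => ?_)
  simp only
  rw [ENNReal.toReal_ofReal (Real.rpow_nonneg (bracket_pos x).le _), smul_eq_mul,
    ← Real.rpow_mul_natCast (bracket_pos x).le, ← Real.rpow_add (bracket_pos x), bracket,
    Real.sqrt_eq_rpow, ← Real.rpow_mul (by positivity), Real.norm_eq_abs, sq_abs]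
  congr 1
  push_cast
  ring

/-- The density, with respect to `weight s`, of integration against `a` over the real line. -/
noncomputable def dens (s : ℝ) (a : ℝ → ℂ) (y : ℝ) : ℂ := a y * ((bracket y ^ (-(2 * s)) : ℝ) : ℂ)

lemma measurable_dens {s : ℝ} {a : ℝ → ℂ} (ha : Measurable a) : Measurable (dens s a) :=
  ha.mul (Complex.measurable_ofReal.comp (continuous_bracket_rpow _).measurable)

lemma norm_dens (s : ℝ) (a : ℝ → ℂ) (y : ℝ) :
    ‖dens s a y‖ = ‖a y‖ * bracket y ^ (-(2 * s)) := by
  rw [dens, norm_mul, Complex.norm_real, Real.norm_of_nonneg (Real.rpow_nonneg (bracket_pos y).le _)]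

lemma weight_mul_dens (s : ℝ) (a f : ℝ → ℂ) (y : ℝ) :
    ((bracket y ^ (2 * s) : ℝ) : ℂ) * (dens s a y * f y) = a y * f y := by
  have : ((bracket y ^ (2 * s) : ℝ) : ℂ) * ((bracket y ^ (-(2 * s)) : ℝ) : ℂ) = 1 := by
    rw [← Complex.ofReal_mul, ← Real.rpow_add (bracket_pos y)]; simp
  rw [dens]
  linear_combination (a y * f y) * this

lemma integral_dens_mul (s : ℝ) (a f : ℝ → ℂ) :
    ∫ y, dens s a y * f y ∂weight s = ∫ y, a y * f y := by
  rw [integral_weight]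
  simp only [weight_mul_dens]

lemma norm_dens_le {s C : ℝ} {a : ℝ → ℂ} (hC : ∀ y, ‖a y‖ ≤ C * bracket y) (y : ℝ) :
    ‖dens s a y‖ ≤ C * bracket y ^ (1 - 2 * s) := by
  rw [norm_dens]
  calc ‖a y‖ * bracket y ^ (-(2 * s)) ≤ C * bracket y * bracket y ^ (-(2 * s)) := by
        gcongr
        · exact Real.rpow_nonneg (bracket_pos y).le _
        · exact hC y
    _ = C * bracket y ^ (1 - 2 * s) := by
        rw [sub_eq_neg_add, Real.rpow_add_one (bracket_pos y).ne']; ring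

/-- Dual form of the threshold: 2(1 - 2s) + 2s < -1 exactly when s > 3/2. -/
lemma memLp_bracket_dens {s : ℝ} (hs : 3 / 2 < s) :
    MemLp (fun y => bracket y ^ (1 - 2 * s)) 2 (weight s) :=
  memLp_bracket_rpow (by linarith)

lemma memLp_dens {s C : ℝ} (hs : 3 / 2 < s) {a : ℝ → ℂ} (ha : Measurable a)
    (hC : ∀ y, ‖a y‖ ≤ C * bracket y) : MemLp (dens s a) 2 (weight s) :=
  ((memLp_bracket_dens hs).const_mul C).mono' (measurable_dens ha).aestronglyMeasurable
    (Eventually.of_forall (norm_dens_le hC))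

lemma integrable_mul_of_memLp_weight {s C : ℝ} (hs : 3 / 2 < s) {a f : ℝ → ℂ} (ha : Measurable a)
    (hC : ∀ y, ‖a y‖ ≤ C * bracket y) (hf : MemLp f 2 (weight s)) :
    Integrable fun y => a y * f y := by
  have h := (memLp_dens hs ha hC).integrable_mul hf
  rw [integrable_weight_iff] at h
  refine h.congr (Eventually.of_forall fun y => ?_)
  exact weight_mul_dens s a f y

lemma integrable_of_memLp_weight {s : ℝ} (hs : 3 / 2 < s) {f : ℝ → ℂ}
    (hf : MemLp f 2 (weight s)) : Integrable f := by
  simpa using integrable_mul_of_memLp_weight (a := fun _ => 1) (C := 1) hs measurable_const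
    (fun y => by simpa using one_le_bracket y) hf

lemma memLp_weight_neg_of_le {s C : ℝ} (hs : 3 / 2 < s) {f : ℝ → ℂ}
    (hf : AEStronglyMeasurable f (weight (-s)))
    (hC : ∀ y, ‖f y‖ ≤ C * bracket y) : MemLp f 2 (weight (-s)) := by
  have h := (memLp_bracket_rpow (r := 1) (t := -s) (by linarith)).const_mul C
  refine h.mono' hf (Eventually.of_forall fun y => ?_)
  simpa using hC y

lemma memLp_bracket_mul_dens {s s' : ℝ} (hs : 3 / 2 < s) (hs' : 3 / 2 < s') (C : ℝ) :
    MemLp (fun x : ℝ × ℝ => C * (bracket x.1 ^ (1 : ℝ) * bracket x.2 ^ (1 - 2 * s))) 2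
      ((weight (-s')).prod (weight s)) :=
  (MemLp.mul_prod (memLp_bracket_rpow (by linarith)) (memLp_bracket_dens hs)).const_mul C

lemma norm_kernel_le {s C : ℝ} {k : ℝ → ℝ → ℂ} (hC : ∀ x y, ‖k x y‖ ≤ C * bracket x * bracket y)
    (x : ℝ × ℝ) :
    ‖dens s (k x.1) x.2‖ ≤ C * (bracket x.1 ^ (1 : ℝ) * bracket x.2 ^ (1 - 2 * s)) := by
  have := norm_dens_le (s := s) (hC x.1) x.2
  rw [Real.rpow_one, ← mul_assoc]
  exact this

lemma measurable_kernel {s : ℝ} {k : ℝ → ℝ → ℂ} (hk : Measurable fun x : ℝ × ℝ => k x.1 x.2) :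
    Measurable fun x : ℝ × ℝ => dens s (k x.1) x.2 :=
  hk.mul (Complex.measurable_ofReal.comp
    ((continuous_bracket_rpow (-(2 * s))).measurable.comp measurable_snd))

lemma memLp_dens_kernel {s s' C : ℝ} (hs : 3 / 2 < s) (hs' : 3 / 2 < s') {k : ℝ → ℝ → ℂ}
    (hk : Measurable fun x : ℝ × ℝ => k x.1 x.2)
    (hC : ∀ x y, ‖k x y‖ ≤ C * bracket x * bracket y) :
    MemLp (fun x : ℝ × ℝ => dens s (k x.1) x.2) 2 ((weight (-s')).prod (weight s)) :=
  (memLp_bracket_mul_dens hs hs' C).mono' (measurable_kernel hk).aestronglyMeasurable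
    (Eventually.of_forall (norm_kernel_le hC))

noncomputable section

/-- The operator `L²_s → L²_{-s'}` with kernel `k`. -/
def kernelOp {s s' C : ℝ} (hs : 3 / 2 < s) (hs' : 3 / 2 < s') (k : ℝ → ℝ → ℂ)
    (hk : Measurable fun x : ℝ × ℝ => k x.1 x.2)
    (hC : ∀ x y, ‖k x y‖ ≤ C * bracket x * bracket y) : L2w s →L[ℂ] L2w (-s') :=
  hsOp _ (memLp_dens_kernel hs hs' hk hC)

lemma kernelOp_coeFn {s s' C : ℝ} (hs : 3 / 2 < s) (hs' : 3 / 2 < s') (k : ℝ → ℝ → ℂ)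
    (hk : Measurable fun x : ℝ × ℝ => k x.1 x.2)
    (hC : ∀ x y, ‖k x y‖ ≤ C * bracket x * bracket y) (f : L2w s) :
    kernelOp hs hs' k hk hC f =ᵐ[volume] fun x => ∫ y, k x y * f y := by
  rw [← ae_weight (-s')]
  refine (hsOp_coeFn _ (memLp_dens_kernel hs hs' hk hC) f).trans (Eventually.of_forall fun x => ?_)
  exact integral_dens_mul s (k x) f

lemma tendsto_kernelOp {s s' C : ℝ} (hs : 3 / 2 < s) (hs' : 3 / 2 < s') {ι : Type*} {l : Filter ι}
    [l.IsCountablyGenerated] {k : ι → ℝ → ℝ → ℂ} {k₀ : ℝ → ℝ → ℂ}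
    (hk : ∀ i, Measurable fun x : ℝ × ℝ => k i x.1 x.2)
    (hC : ∀ i x y, ‖k i x y‖ ≤ C * bracket x * bracket y)
    (hk₀ : Measurable fun x : ℝ × ℝ => k₀ x.1 x.2)
    (hC₀ : ∀ x y, ‖k₀ x y‖ ≤ C * bracket x * bracket y)
    (hlim : ∀ x y, Tendsto (fun i => k i x y) l (𝓝 (k₀ x y))) :
    Tendsto (fun i => kernelOp hs hs' (k i) (hk i) (hC i)) l
      (𝓝 (kernelOp hs hs' k₀ hk₀ hC₀)) :=
  tendsto_hsOp_of_dominated (fun i => measurable_kernel (hk i)) (measurable_kernel hk₀) _ _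
    (memLp_bracket_mul_dens hs hs' C) (Eventually.of_forall fun i => norm_kernel_le (hC i))
    (norm_kernel_le hC₀) fun x => (hlim x.1 x.2).mul_const _

/-- The functional `f ↦ ∫ a f` on `L²_s`. -/
def pairing {s C : ℝ} (hs : 3 / 2 < s) (a : ℝ → ℂ) (ha : Measurable a)
    (hC : ∀ y, ‖a y‖ ≤ C * bracket y) : L2w s →L[ℂ] ℂ :=
  (ContinuousLinearMap.mul ℂ ℂ).lpPairing (weight s) 2 2 ((memLp_dens hs ha hC).toLp (dens s a))

lemma pairing_apply {s C : ℝ} (hs : 3 / 2 < s) (a : ℝ → ℂ) (ha : Measurable a)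
    (hC : ∀ y, ‖a y‖ ≤ C * bracket y) (f : L2w s) : pairing hs a ha hC f = ∫ y, a y * f y := by
  rw [pairing, ContinuousLinearMap.lpPairing_eq_integral, ← integral_dens_mul s]
  refine integral_congr_ae ?_
  filter_upwards [(memLp_dens hs ha hC).coeFn_toLp] with y hy
  simp [hy]

lemma tendsto_pairing {s C : ℝ} (hs : 3 / 2 < s) {ι : Type*} {l : Filter ι}
    [l.IsCountablyGenerated] {a : ι → ℝ → ℂ} {a₀ : ℝ → ℂ}
    (ha : ∀ i, Measurable (a i)) (hC : ∀ i y, ‖a i y‖ ≤ C * bracket y)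
    (ha₀ : Measurable a₀) (hC₀ : ∀ y, ‖a₀ y‖ ≤ C * bracket y)
    (hlim : ∀ y, Tendsto (fun i => a i y) l (𝓝 (a₀ y))) :
    Tendsto (fun i => pairing hs (a i) (ha i) (hC i)) l (𝓝 (pairing hs a₀ ha₀ hC₀)) := by
  refine (((ContinuousLinearMap.mul ℂ ℂ).lpPairing (weight s) 2 2).continuous.tendsto _).comp ?_
  exact tendsto_toLp_of_dominated (fun i => measurable_dens (ha i)) (measurable_dens ha₀) _ _
    ((memLp_bracket_dens hs).const_mul C) (Eventually.of_forall fun i => norm_dens_le (hC i))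
    (norm_dens_le hC₀) fun x => (hlim x).mul_const _

/-! ### Multiplication by the potential between weighted spaces -/

lemma exists_bound_mul_bracket {V : ℝ → ℂ} (hV : Continuous V) (hc : HasCompactSupport V) (r : ℝ) :
    ∃ C, ∀ x, ‖V x‖ * bracket x ^ r ≤ C := by
  have h1 : Continuous fun x => V x * ((bracket x ^ r : ℝ) : ℂ) :=
    hV.mul (Complex.continuous_ofReal.comp (continuous_bracket_rpow r))
  obtain ⟨C, hC⟩ := h1.bounded_above_of_compact_support hc.mul_right
  refine ⟨C, fun x => ?_⟩
  have := hC x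
  rwa [norm_mul, Complex.norm_real,
    Real.norm_of_nonneg (Real.rpow_nonneg (bracket_pos x).le _)] at this

lemma eLpNorm_mul_potential_le {V : ℝ → ℂ} {s t C : ℝ}
    (hC : ∀ x, ‖V x‖ * bracket x ^ (s - t) ≤ C) (f : ℝ → ℂ) :
    eLpNorm (fun x => V x * f x) 2 (weight s) ≤ ENNReal.ofReal C * eLpNorm f 2 (weight t) := by
  rw [← ENNReal.pow_le_pow_left_iff two_ne_zero, mul_pow, eLpNorm_two_sq, eLpNorm_two_sq,
    lintegral_weight, lintegral_weight, ← lintegral_const_mul' _ _ (by finiteness)]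
  refine lintegral_mono fun x => ?_
  have hb : bracket x ^ (2 * s) * ‖V x‖ ^ 2 ≤ C ^ 2 * bracket x ^ (2 * t) := by
    have e : bracket x ^ (2 * s) * ‖V x‖ ^ 2
        = (‖V x‖ * bracket x ^ (s - t)) ^ 2 * bracket x ^ (2 * t) := by
      rw [mul_pow, ← Real.rpow_mul_natCast (bracket_pos x).le, mul_assoc,
        ← Real.rpow_add (bracket_pos x), mul_comm]
      congr 2
      push_cast
      ring
    rw [e]
    have h0 : 0 ≤ ‖V x‖ * bracket x ^ (s - t) :=
      mul_nonneg (norm_nonneg _) (Real.rpow_nonneg (bracket_pos x).le _)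
    have := Real.rpow_nonneg (bracket_pos x).le (2 * t)
    gcongr
    exact hC x
  have hC0 : 0 ≤ C := le_trans
    (mul_nonneg (norm_nonneg _) (Real.rpow_nonneg (bracket_pos x).le _)) (hC x)
  simp only [enorm_mul, mul_pow]
  rw [← mul_assoc, ← mul_assoc]
  gcongr ?_ * _
  rw [← ofReal_norm, ← ENNReal.ofReal_pow (norm_nonneg _), ← ENNReal.ofReal_pow hC0,
    ← ENNReal.ofReal_mul (Real.rpow_nonneg (bracket_pos x).le _), ← ENNReal.ofReal_mul (by positivity)]
  exact ENNReal.ofReal_le_ofReal hb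

lemma memLp_mul_potential {V : ℝ → ℂ} (hV : Continuous V) (hc : HasCompactSupport V) {s t : ℝ}
    (f : L2w t) : MemLp (fun x => V x * f x) 2 (weight s) :=
  ⟨hV.aestronglyMeasurable.mul (aestronglyMeasurable_weight (Lp.memLp f).1),
    (eLpNorm_mul_potential_le (exists_bound_mul_bracket hV hc (s - t)).choose_spec f).trans_lt
      (ENNReal.mul_lt_top ENNReal.ofReal_lt_top (Lp.memLp f).2)⟩

/-- Multiplication by a continuous compactly supported function, between weighted spaces. -/
def mulWeight (V : ℝ → ℂ) (hV : Continuous V) (hc : HasCompactSupport V) (t s : ℝ) :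
    L2w t →L[ℂ] L2w s :=
  LinearMap.mkContinuous
    { toFun := fun f => (memLp_mul_potential hV hc f).toLp _
      map_add' := fun f g => by
        rw [← MemLp.toLp_add]
        refine MemLp.toLp_congr _ _ ?_
        have h := Lp.coeFn_add f g
        rw [EventuallyEq, ae_weight] at h
        rw [EventuallyEq, ae_weight]
        filter_upwards [h] with x hx
        rw [hx, Pi.add_apply, Pi.add_apply, mul_add]
      map_smul' := fun c f => by
        rw [RingHom.id_apply, ← MemLp.toLp_const_smul]
        refine MemLp.toLp_congr _ _ ?_
        have h := Lp.coeFn_smul c f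
        rw [EventuallyEq, ae_weight] at h
        rw [EventuallyEq, ae_weight]
        filter_upwards [h] with x hx
        rw [hx, Pi.smul_apply, Pi.smul_apply, smul_eq_mul, smul_eq_mul]
        ring }
    (ENNReal.ofReal (exists_bound_mul_bracket hV hc (s - t)).choose).toReal fun f => by
      rw [LinearMap.coe_mk, AddHom.coe_mk, Lp.norm_toLp, Lp.norm_def, ← ENNReal.toReal_mul]
      exact ENNReal.toReal_mono
        (ENNReal.mul_ne_top ENNReal.ofReal_ne_top (Lp.eLpNorm_ne_top f))
        (eLpNorm_mul_potential_le (exists_bound_mul_bracket hV hc (s - t)).choose_spec f)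

lemma mulWeight_coeFn (V : ℝ → ℂ) (hV : Continuous V) (hc : HasCompactSupport V) (t s : ℝ)
    (f : L2w t) : mulWeight V hV hc t s f =ᵐ[volume] fun x => V x * f x := by
  rw [← ae_weight s]
  exact (memLp_mul_potential hV hc f).coeFn_toLp

lemma inclusion_coeFn {μ ν : Measure ℝ} (h : μ ≤ ν) (f : Lp ℂ 2 ν) : inclusion h f =ᵐ[μ] f :=
  ((Lp.memLp f).mono_measure h).coeFn_toLp

lemma embIn_coeFn {s : ℝ} (hs : 0 ≤ s) (f : L2w s) : embIn hs f =ᵐ[volume] f :=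
  inclusion_coeFn _ f

lemma embOut_coeFn {s : ℝ} (hs : 0 ≤ s) (f : L2) : embOut hs f =ᵐ[volume] f := by
  rw [← ae_weight (-s)]
  exact inclusion_coeFn _ f

/-- Compact support lets V map L²_{-s'} into L²_s, so the perturbation has the form j V J and only
the weighted resolvent J R j enters the perturbation argument. -/
lemma mulOp_eq_comp (V : ℝ → ℂ) (hV : Continuous V) (hc : HasCompactSupport V) {s s' : ℝ}
    (hs : 0 ≤ s) (hs' : 0 ≤ s') :
    mulOp V hV hc = embIn hs ∘L mulWeight V hV hc (-s') s ∘L embOut hs' := by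
  refine ContinuousLinearMap.ext fun f => Lp.ext ?_
  simp only [ContinuousLinearMap.comp_apply]
  have h1 : mulOp V hV hc f =ᵐ[volume] fun x => (memLp_potential V hV hc).toLp V x * f x :=
    (ContinuousLinearMap.mul ℂ ℂ).coeFn_holder _ _
  filter_upwards [h1, (memLp_potential V hV hc).coeFn_toLp,
    embIn_coeFn hs (mulWeight V hV hc (-s') s (embOut hs' f)),
    mulWeight_coeFn V hV hc (-s') s (embOut hs' f), embOut_coeFn hs' f] with x h1 h2 h3 h4 h5
  rw [h1, h2, h3, h4, h5]

end

end Weight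

/-! ### Perturbation of a resolvent with a rank-one singularity -/

noncomputable section Perturbation

variable {X Y : Type*} [NormedAddCommGroup X] [NormedSpace ℂ X]
  [NormedAddCommGroup Y] [NormedSpace ℂ Y]

/-- The second resolvent identity, with S the two-sided inverse of 1 + J R j V on the weighted
space. -/
lemma IsResolvent.perturb {T : L2 →ₗ.[ℂ] L2} {z : ℂ} {R : L2 →L[ℂ] L2} (hR : IsResolvent T z R)
    (j : X →L[ℂ] L2) (J : L2 →L[ℂ] Y) (V : Y →L[ℂ] X) (S : Y →L[ℂ] Y)
    (hS : ∀ u, S (u + J (R (j (V u)))) = u) (hS' : ∀ u, S u + J (R (j (V (S u)))) = u) :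
    IsResolvent (((j ∘L V ∘L J : L2 →L[ℂ] L2) : L2 →ₗ[ℂ] L2) +ᵥ T) z
      (R - R ∘L j ∘L V ∘L S ∘L J ∘L R) := by
  constructor
  · intro f
    -- The candidate applied to f is R of this vector, so it lies in the domain of T.
    obtain ⟨h, hf⟩ := hR.1 (f - j (V (S (J (R f)))))
    have e : (R - R ∘L j ∘L V ∘L S ∘L J ∘L R) f = R (f - j (V (S (J (R f))))) := by simp
    have key : J (R (f - j (V (S (J (R f)))))) = S (J (R f)) := by
      rw [map_sub, map_sub, sub_eq_iff_eq_add, hS']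
    simp only [e]
    refine ⟨h, ?_⟩
    rw [LinearPMap.vadd_apply]
    simp only [ContinuousLinearMap.coe_coe, ContinuousLinearMap.comp_apply, key]
    rw [add_sub_assoc]
    erw [hf]
    abel
  · intro u
    have h := hR.2 u
    rw [LinearPMap.vadd_apply]
    have e : ((j ∘L V ∘L J : L2 →L[ℂ] L2) : L2 →ₗ[ℂ] L2) (u : L2) + T u - z • (u : L2)
        = j (V (J u)) + (T u - z • (u : L2)) := by simp; abel
    erw [e]
    have e2 : R (j (V (J u)) + (T u - z • (u : L2))) = u + R (j (V (J u))) := by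
      rw [map_add, h, add_comm]
    simp only [sub_apply, ContinuousLinearMap.comp_apply, e2]
    rw [map_add, hS]
    abel

lemma tendsto_clm_comp {E F F' : Type*} [NormedAddCommGroup E] [NormedSpace ℂ E]
    [NormedAddCommGroup F] [NormedSpace ℂ F] [NormedAddCommGroup F'] [NormedSpace ℂ F']
    {ι : Type*} {l : Filter ι} {f : ι → F →L[ℂ] F'} {g : ι → E →L[ℂ] F} {f₀ : F →L[ℂ] F'}
    {g₀ : E →L[ℂ] F} (hf : Tendsto f l (𝓝 f₀)) (hg : Tendsto g l (𝓝 g₀)) :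
    Tendsto (fun i => f i ∘L g i) l (𝓝 (f₀ ∘L g₀)) :=
  (isBoundedBilinearMap_comp.continuous.tendsto (f₀, g₀)).comp (hf.prodMk_nhds hg)

lemma tendsto_clm_apply {E F : Type*} [NormedAddCommGroup E] [NormedSpace ℂ E]
    [NormedAddCommGroup F] [NormedSpace ℂ F]
    {ι : Type*} {l : Filter ι} {f : ι → E →L[ℂ] F} {x : ι → E} {f₀ : E →L[ℂ] F}
    {x₀ : E} (hf : Tendsto f l (𝓝 f₀)) (hx : Tendsto x l (𝓝 x₀)) :
    Tendsto (fun i => f i (x i)) l (𝓝 (f₀ x₀)) :=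
  (isBoundedBilinearMap_apply.continuous.tendsto (f₀, x₀)).comp (hf.prodMk_nhds hx)

/-- The block operator `(u, c) ↦ (u + G V u - c p, q (V u) + k c)`. -/
def blockOp (G : X →L[ℂ] Y) (V : Y →L[ℂ] X) (p : Y) (q : X →L[ℂ] ℂ) (k : ℂ) :
    (Y × ℂ) →L[ℂ] (Y × ℂ) :=
  (ContinuousLinearMap.fst ℂ Y ℂ + G ∘L V ∘L ContinuousLinearMap.fst ℂ Y ℂ
      - (ContinuousLinearMap.snd ℂ Y ℂ).smulRight p).prod
    (q ∘L V ∘L ContinuousLinearMap.fst ℂ Y ℂ + k • ContinuousLinearMap.snd ℂ Y ℂ)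

lemma blockOp_apply (G : X →L[ℂ] Y) (V : Y →L[ℂ] X) (p : Y) (q : X →L[ℂ] ℂ) (k : ℂ) (u : Y)
    (c : ℂ) : blockOp G V p q k (u, c) = (u + G (V u) - c • p, q (V u) + k * c) := by
  simp [blockOp]

lemma tendsto_blockOp {ι : Type*} {l : Filter ι} {G : ι → X →L[ℂ] Y} {G₀ : X →L[ℂ] Y}
    (V : Y →L[ℂ] X) {p : ι → Y} {p₀ : Y} {q : ι → X →L[ℂ] ℂ} {q₀ : X →L[ℂ] ℂ} {k : ι → ℂ} {k₀ : ℂ}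
    (hG : Tendsto G l (𝓝 G₀)) (hp : Tendsto p l (𝓝 p₀)) (hq : Tendsto q l (𝓝 q₀))
    (hk : Tendsto k l (𝓝 k₀)) :
    Tendsto (fun i => blockOp (G i) V (p i) (q i) (k i)) l (𝓝 (blockOp G₀ V p₀ q₀ k₀)) := by
  -- Written with compositions and sums only, the block operator is visibly norm continuous in its
  -- four entries.
  have e : ∀ (G : X →L[ℂ] Y) (p : Y) (q : X →L[ℂ] ℂ) (k : ℂ), blockOp G V p q k =
      ContinuousLinearMap.inl ℂ Y ℂ ∘L (ContinuousLinearMap.fst ℂ Y ℂ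
        + G ∘L V ∘L ContinuousLinearMap.fst ℂ Y ℂ
        - ContinuousLinearMap.smulRightL ℂ (Y × ℂ) Y (ContinuousLinearMap.snd ℂ Y ℂ) p)
      + ContinuousLinearMap.inr ℂ Y ℂ ∘L (q ∘L V ∘L ContinuousLinearMap.fst ℂ Y ℂ
        + k • ContinuousLinearMap.snd ℂ Y ℂ) := fun G p q k => by
    refine ContinuousLinearMap.ext fun ⟨u, c⟩ => ?_
    rw [blockOp_apply]
    ext <;> simp
  simp only [e]
  refine (tendsto_clm_comp tendsto_const_nhds ?_).add (tendsto_clm_comp tendsto_const_nhds ?_)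
  · exact (tendsto_const_nhds.add (tendsto_clm_comp hG tendsto_const_nhds)).sub
      (((ContinuousLinearMap.smulRightL ℂ (Y × ℂ) Y _).continuous.tendsto p₀).comp hp)
  · exact (tendsto_clm_comp hq tendsto_const_nhds).add (hk.smul_const _)

/-- Fredholm alternative: the block operator M differs from the identity by GV and finite-rank
terms. If 1 is an eigenvalue of the compact operator 1 - M, then M has a null vector; otherwise M is
invertible. -/
lemma isUnit_blockOp [CompleteSpace Y] {G : X →L[ℂ] Y} {V : Y →L[ℂ] X} {p : Y}
    {q : X →L[ℂ] ℂ} {k : ℂ} (hc : IsCompactOperator (G ∘L V))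
    (hinj : ∀ u c, blockOp G V p q k (u, c) = 0 → u = 0 ∧ c = 0) :
    IsUnit (blockOp G V p q k) := by
  have h1 : IsCompactOperator (ContinuousLinearMap.inl ℂ Y ℂ ∘ (G ∘L V) ∘
      ContinuousLinearMap.fst ℂ Y ℂ) :=
    (hc.comp_clm (ContinuousLinearMap.fst ℂ Y ℂ)).clm_comp (ContinuousLinearMap.inl ℂ Y ℂ)
  have h2 : IsCompactOperator (ContinuousLinearMap.inl ℂ Y ℂ ∘
      (ContinuousLinearMap.toSpanSingleton ℂ p) ∘ ContinuousLinearMap.snd ℂ Y ℂ) :=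
    ((isCompactOperator_of_locallyCompactSpace_dom (ContinuousLinearMap.snd ℂ Y ℂ)).clm_comp
      (ContinuousLinearMap.toSpanSingleton ℂ p)).clm_comp (ContinuousLinearMap.inl ℂ Y ℂ)
  have h3 : IsCompactOperator (ContinuousLinearMap.inr ℂ Y ℂ ∘
      (ContinuousLinearMap.snd ℂ Y ℂ - (q ∘L V ∘L ContinuousLinearMap.fst ℂ Y ℂ
        + k • ContinuousLinearMap.snd ℂ Y ℂ) : (Y × ℂ) →L[ℂ] ℂ)) :=
    (isCompactOperator_of_locallyCompactSpace_dom _).clm_comp (ContinuousLinearMap.inr ℂ Y ℂ)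
  have hK : IsCompactOperator ((1 - blockOp G V p q k : (Y × ℂ) →L[ℂ] (Y × ℂ))) := by
    convert! (h1.neg).add (h2.add h3) using 1
    funext ⟨u, c⟩
    rw [sub_apply, blockOp_apply]
    ext <;> simp
    abel
  rcases hK.hasEigenvalue_or_mem_resolventSet one_ne_zero with h | h
  · obtain ⟨⟨u, c⟩, hx⟩ := h.exists_hasEigenvector
    exfalso
    have h1 := hx.apply_eq_smul
    have h2 : blockOp G V p q k (u, c) = 0 := by
      simpa using h1
    obtain ⟨rfl, rfl⟩ := hinj u c h2
    exact hx.2 rfl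
  · rw [spectrum.mem_resolventSet_iff] at h
    simpa using h

variable {ι : Type*} {l : Filter ι} {z : ι → ℂ} {T : L2 →ₗ.[ℂ] L2}
  {j : X →L[ℂ] L2} {J : L2 →L[ℂ] Y} {V : Y →L[ℂ] X} {R : ι → L2 →L[ℂ] L2}
  {G : ι → X →L[ℂ] Y} {G₀ : X →L[ℂ] Y} {p : ι → Y} {p₀ : Y} {q : ι → X →L[ℂ] ℂ} {q₀ : X →L[ℂ] ℂ}
  {κ : ι → ℂ}

/-- Substituting c = -κ q(Vu) turns u + J R j V u = v into M(u, c) = (v, 0), where κ enters only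
through κ⁻¹. The resulting formula for the weighted perturbed resolvent contains no growing factor.
-/
lemma exists_resolvent_of_isUnit_blockOp {z κ : ℂ} {R : L2 →L[ℂ] L2} (hR : IsResolvent T z R)
    (hκ : κ ≠ 0) {G : X →L[ℂ] Y} {p : Y} {q : X →L[ℂ] ℂ}
    (hG : ∀ f, J (R (j f)) = G f + (κ * q f) • p) (hu : IsUnit (blockOp G V p q κ⁻¹)) :
    ∃ R' : L2 →L[ℂ] L2,
      IsResolvent (((j ∘L V ∘L J : L2 →L[ℂ] L2) : L2 →ₗ[ℂ] L2) +ᵥ T) z R' ∧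
      J ∘L R' ∘L j = ContinuousLinearMap.fst ℂ Y ℂ ∘L Ring.inverse (blockOp G V p q κ⁻¹) ∘L
        (G.prod q) := by
  set M := blockOp G V p q κ⁻¹ with hM
  set N := Ring.inverse M
  have hNM : ∀ a, N (M a) = a := fun a => by
    have := Ring.inverse_mul_cancel M hu
    exact DFunLike.congr_fun this a
  have hMN : ∀ a, M (N a) = a := fun a => by
    have := Ring.mul_inverse_cancel M hu
    exact DFunLike.congr_fun this a
  set S : Y →L[ℂ] Y := ContinuousLinearMap.fst ℂ Y ℂ ∘L N ∘L ContinuousLinearMap.inl ℂ Y ℂ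
  have hMu : ∀ u, M (u, -(κ * q (V u))) = (u + J (R (j (V u))), 0) := fun u => by
    rw [hM, blockOp_apply, hG]
    ext
    · simp [add_assoc]
    · simp [hκ]
  have hS : ∀ u, S (u + J (R (j (V u)))) = u := fun u => by
    have := hNM (u, -(κ * q (V u)))
    rw [hMu] at this
    simp [S, this]
  have hS' : ∀ u, S u + J (R (j (V (S u)))) = u := fun u => by
    have h1 := hMN (u, 0)
    obtain ⟨⟨v, c⟩, hv⟩ : ∃ a, N (u, 0) = a := ⟨_, rfl⟩
    have hSu : S u = v := by simp [S, hv]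
    rw [hv, hM, blockOp_apply, Prod.mk.injEq] at h1
    have h2 : c = -(κ * q (V v)) := by
      have := h1.2
      field_simp at this
      linear_combination this
    rw [hSu, hG, ← h1.1, h2]
    module
  refine ⟨_, hR.perturb j J V S hS hS', ?_⟩
  ext f
  have h1 : J ((R - R ∘L j ∘L V ∘L S ∘L J ∘L R) (j f)) = S (J (R (j f))) := by
    have := hS' (J (R (j f)))
    simp only [sub_apply, ContinuousLinearMap.comp_apply, map_sub]
    rw [sub_eq_iff_eq_add, this]
  -- M(0, κ q(f)) = (-κ q(f) p, q(f)) cancels the singular part of J R j f, and the correction is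
  -- invisible in the first component.
  have h2 : N (G f, q f) = N (J (R (j f)), 0) + (0, κ * q f) := by
    rw [← hNM (N (J (R (j f)), 0) + (0, κ * q f)), map_add, hMN]
    congr 1
    rw [hM, blockOp_apply, hG]
    ext <;> simp [hκ]
  simp only [ContinuousLinearMap.comp_apply, h1, ContinuousLinearMap.prod_apply, h2]
  simp [S]

/-- Units are open and inversion is continuous there, so invertibility of the limiting block
operator gives both eventual existence and norm convergence. -/
theorem exists_tendsto_resolvent [CompleteSpace Y]
    (hR : ∀ᶠ i in l, IsResolvent T (z i) (R i)) (hκ : ∀ᶠ i in l, κ i ≠ 0)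
    (hG : ∀ᶠ i in l, ∀ f, J (R i (j f)) = G i f + (κ i * q i f) • p i)
    (tG : Tendsto G l (𝓝 G₀)) (tp : Tendsto p l (𝓝 p₀)) (tq : Tendsto q l (𝓝 q₀))
    (tκ : Tendsto (fun i => (κ i)⁻¹) l (𝓝 0)) (hc : IsCompactOperator (G₀ ∘L V))
    (hinj : ∀ u c, blockOp G₀ V p₀ q₀ 0 (u, c) = 0 → u = 0 ∧ c = 0) :
    ∃ R' : ι → L2 →L[ℂ] L2,
      (∀ᶠ i in l, IsResolvent (((j ∘L V ∘L J : L2 →L[ℂ] L2) : L2 →ₗ[ℂ] L2) +ᵥ T) (z i) (R' i)) ∧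
      ∃ L : X →L[ℂ] Y, Tendsto (fun i => J ∘L R' i ∘L j) l (𝓝 L) := by
  have hu := isUnit_blockOp hc hinj
  have tM := tendsto_blockOp V tG tp tq tκ
  have hunit : ∀ᶠ i in l, IsUnit (blockOp (G i) V (p i) (q i) (κ i)⁻¹) :=
    tM.eventually (Units.isOpen.mem_nhds hu)
  have hex : ∀ᶠ i in l, ∃ R' : L2 →L[ℂ] L2,
      IsResolvent (((j ∘L V ∘L J : L2 →L[ℂ] L2) : L2 →ₗ[ℂ] L2) +ᵥ T) (z i) R' ∧
      J ∘L R' ∘L j = ContinuousLinearMap.fst ℂ Y ℂ ∘L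
        Ring.inverse (blockOp (G i) V (p i) (q i) (κ i)⁻¹) ∘L ((G i).prod (q i)) := by
    filter_upwards [hR, hκ, hG, hunit] with i h1 h2 h3 h4
    exact exists_resolvent_of_isUnit_blockOp h1 h2 h3 h4
  obtain ⟨R', hR'⟩ := skolem.mp hex
  refine ⟨R', hR'.mono fun i h => h.1,
    ContinuousLinearMap.fst ℂ Y ℂ ∘L Ring.inverse (blockOp G₀ V p₀ q₀ 0) ∘L (G₀.prod q₀), ?_⟩
  have tinv : Tendsto (fun i => Ring.inverse (blockOp (G i) V (p i) (q i) (κ i)⁻¹)) l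
      (𝓝 (Ring.inverse (blockOp G₀ V p₀ q₀ 0))) := by
    obtain ⟨u, hu'⟩ := hu
    have := NormedRing.inverse_continuousAt u
    rw [hu'] at this
    exact this.tendsto.comp tM
  have tGq : Tendsto (fun i => (G i).prod (q i)) l (𝓝 (G₀.prod q₀)) := by
    have e : ∀ (G : X →L[ℂ] Y) (q : X →L[ℂ] ℂ), G.prod q =
        ContinuousLinearMap.inl ℂ Y ℂ ∘L G + ContinuousLinearMap.inr ℂ Y ℂ ∘L q := fun G q => by
      ext <;> simp
    simp only [e]
    exact (tendsto_clm_comp tendsto_const_nhds tG).add (tendsto_clm_comp tendsto_const_nhds tq)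
  refine Tendsto.congr' (hR'.mono fun i h => h.2.symm) ?_
  exact tendsto_clm_comp tendsto_const_nhds (tendsto_clm_comp tinv tGq)

/-- Data g → -Vu are chosen so that J R j g → u, although J R j itself may diverge. The perturbed
resolvent sends g + V J R j g → 0 to the same outputs, so its convergence forces u = 0. -/
theorem eq_zero_of_tendsto_resolvent [l.NeBot]
    (hR : ∀ᶠ i in l, IsResolvent T (z i) (R i)) (hκ : ∀ᶠ i in l, κ i ≠ 0)
    (hG : ∀ᶠ i in l, ∀ f, J (R i (j f)) = G i f + (κ i * q i f) • p i)
    (tG : Tendsto G l (𝓝 G₀)) (tp : Tendsto p l (𝓝 p₀)) (tq : Tendsto q l (𝓝 q₀))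
    (tκ : Tendsto (fun i => (κ i)⁻¹) l (𝓝 0)) {φ : X} (hφ : q₀ φ ≠ 0)
    {R' : ι → L2 →L[ℂ] L2}
    (hR' : ∀ᶠ i in l,
      IsResolvent (((j ∘L V ∘L J : L2 →L[ℂ] L2) : L2 →ₗ[ℂ] L2) +ᵥ T) (z i) (R' i))
    {L : X →L[ℂ] Y} (hL : Tendsto (fun i => J ∘L R' i ∘L j) l (𝓝 L))
    {u : Y} {c : ℂ} (huc : blockOp G₀ V p₀ q₀ 0 (u, c) = 0) : u = 0 := by
  rw [blockOp_apply, Prod.mk_eq_zero, zero_mul, add_zero] at huc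
  obtain ⟨hu, hq0⟩ := huc
  -- The size of ε is dictated by κ q(ε φ - Vu) = c, which makes the singular contribution equal to
  -- c p; it tends to 0 because q₀(Vu) = 0.
  set ε : ι → ℂ := fun i => (c * (κ i)⁻¹ + q i (V u)) / q i φ with hε
  have tqv : ∀ v, Tendsto (fun i => q i v) l (𝓝 (q₀ v)) := fun v =>
    ((ContinuousLinearMap.apply ℂ ℂ v).continuous.tendsto q₀).comp tq
  have tε : Tendsto ε l (𝓝 0) := by
    have := ((tκ.const_mul c).add (tqv (V u))).div (tqv φ) hφ
    simp only [mul_zero, hq0, add_zero, zero_div] at this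
    exact this
  set g : ι → X := fun i => ε i • φ - V u
  have tg : Tendsto g l (𝓝 (-(V u))) := by
    simpa using (tε.smul_const φ).sub_const (V u)
  have hJ : ∀ᶠ i in l, J (R i (j (g i))) = G i (g i) + c • p i := by
    filter_upwards [hG, hκ, (tqv φ).eventually_ne hφ] with i h1 h2 h3
    rw [h1]
    congr 2
    simp only [g, hε, map_sub, map_smul, smul_eq_mul]
    field_simp
    ring
  have tJ : Tendsto (fun i => J (R i (j (g i)))) l (𝓝 u) := by
    have := (tendsto_clm_apply tG tg).add (tp.const_smul c)
    have e : G₀ (-(V u)) + c • p₀ = u := by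
      rw [map_neg]
      linear_combination (norm := module) (-1 : ℂ) • hu
    rw [e] at this
    exact this.congr' (hJ.mono fun i h => h.symm)
  have th : Tendsto (fun i => g i + V (J (R i (j (g i))))) l (𝓝 0) := by
    have := tg.add ((V.continuous.tendsto u).comp tJ)
    simpa using this
  have hJ' : ∀ᶠ i in l, J (R i (j (g i))) = (J ∘L R' i ∘L j) (g i + V (J (R i (j (g i))))) := by
    filter_upwards [hR, hR'] with i h1 h2
    obtain ⟨hd, hf⟩ := h1.1 (j (g i))
    have h3 := h2.2 ⟨R i (j (g i)), hd⟩
    rw [LinearPMap.vadd_apply] at h3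
    have e : ((j ∘L V ∘L J : L2 →L[ℂ] L2) : L2 →ₗ[ℂ] L2) (R i (j (g i)))
        + T ⟨R i (j (g i)), hd⟩ - z i • (R i (j (g i))) =
        j (g i + V (J (R i (j (g i))))) := by
      rw [add_sub_assoc, hf, map_add, add_comm]; rfl
    erw [e] at h3
    simp only [ContinuousLinearMap.comp_apply, h3]
  have t0 := (tendsto_clm_apply hL th).congr' (hJ'.mono fun i h => h.symm)
  rw [map_zero] at t0
  exact tendsto_nhds_unique tJ t0

end Perturbation

/-! ### The free resolvent as a Fourier multiplier -/

noncomputable section FreeResolvent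

open TemperedDistribution FourierTransform

/-- The symbol of `A - z`. -/
def symb (z : ℂ) (x : ℝ) : ℂ := ((2 * Real.pi * x : ℝ) : ℂ) ^ 3 - z

lemma hasTemperateGrowth_symb (z : ℂ) : (symb z).HasTemperateGrowth := by
  unfold symb
  have h : (fun x : ℝ => ((2 * Real.pi * x : ℝ) : ℂ)).HasTemperateGrowth :=
    Function.Complex.hasTemperateGrowth_ofReal.comp (by fun_prop : (fun x : ℝ => 2 * Real.pi * x).HasTemperateGrowth)
  fun_prop

lemma abs_im_le_norm_symb (z : ℂ) (x : ℝ) : |z.im| ≤ ‖symb z x‖ := by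
  have h : (symb z x).im = -z.im := by
    rw [symb, ← Complex.ofReal_pow, Complex.sub_im, Complex.ofReal_im, zero_sub]
  rw [← abs_neg, ← h]
  exact Complex.abs_im_le_norm _

lemma symb_ne_zero {z : ℂ} (hz : 0 < z.im) (x : ℝ) : symb z x ≠ 0 := by
  rw [← norm_pos_iff]
  exact (abs_pos.mpr hz.ne').trans_le (abs_im_le_norm_symb z x)

/-- With y = ((2πx)³ - Re z)/Im z the inverse symbol is (y + i)/(Im z (1 + y²)), which reduces the
claim to temperate growth of (1 + y²)⁻¹. -/
lemma hasTemperateGrowth_inv_symb {z : ℂ} (hz : 0 < z.im) :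
    (fun x => (symb z x)⁻¹).HasTemperateGrowth := by
  set y : ℝ → ℝ := fun x => ((2 * Real.pi * x) ^ 3 - z.re) / z.im
  have hy : y.HasTemperateGrowth := by
    have : y = fun x => ((2 * Real.pi * x) ^ 3 - z.re) * z.im⁻¹ := by
      funext x; simp [y, div_eq_mul_inv]
    rw [this]; fun_prop
  have h1 : (fun x => (1 + ‖y x‖ ^ 2) ^ (-1 : ℝ)).HasTemperateGrowth :=
    (Function.hasTemperateGrowth_one_add_norm_sq_rpow ℝ (-1)).comp hy
  have h2 : (fun x => (((1 + ‖y x‖ ^ 2) ^ (-1 : ℝ) : ℝ) : ℂ)).HasTemperateGrowth :=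
    Function.Complex.hasTemperateGrowth_ofReal.comp h1
  have h3 : (fun x => ((y x : ℝ) : ℂ)).HasTemperateGrowth :=
    Function.Complex.hasTemperateGrowth_ofReal.comp hy
  have e : (fun x => (symb z x)⁻¹) = fun x => ((z.im : ℂ)⁻¹) *
      ((((y x : ℝ) : ℂ) + Complex.I) * (((1 + ‖y x‖ ^ 2) ^ (-1 : ℝ) : ℝ) : ℂ)) := by
    funext x
    have hi : (z.im : ℂ) ≠ 0 := by exact_mod_cast hz.ne'
    have e1 : symb z x = z.im * ((y x : ℂ) - Complex.I) := by
      rw [symb]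
      conv_lhs => rw [← Complex.re_add_im z]
      simp only [y]
      push_cast
      field_simp
      ring
    have e2 : ((y x : ℂ) - Complex.I) * ((y x : ℂ) + Complex.I) = 1 + (y x : ℂ) ^ 2 := by
      ring_nf; rw [Complex.I_sq]; ring
    have e3 : (1 + (y x : ℂ) ^ 2) ≠ 0 := by
      exact_mod_cast (by positivity : (1 + y x ^ 2) ≠ 0)
    have e4 : ((y x : ℂ) - Complex.I) ≠ 0 := fun h => by
      rw [h, zero_mul] at e2; exact e3 e2.symm
    rw [e1, Real.rpow_neg_one, Real.norm_eq_abs, sq_abs]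
    push_cast
    rw [← e2]
    have e5 : ((y x : ℂ) + Complex.I) ≠ 0 := fun h => by
      rw [h, mul_zero] at e2; exact e3 e2.symm
    field_simp
  rw [e]
  fun_prop

lemma norm_inv_symb_le {z : ℂ} (hz : 0 < z.im) (x : ℝ) : ‖(symb z x)⁻¹‖ ≤ z.im⁻¹ := by
  rw [norm_inv]
  have := abs_im_le_norm_symb z x
  rw [abs_of_pos hz] at this
  gcongr

lemma memLp_inv_symb {z : ℂ} (hz : 0 < z.im) :
    MemLp (fun x => (symb z x)⁻¹) ∞ (volume : Measure ℝ) :=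
  memLp_top_of_bound (hasTemperateGrowth_inv_symb hz).1.continuous.aestronglyMeasurable _
    (Eventually.of_forall (norm_inv_symb_le hz))

lemma momentum_eq (u : 𝓢'(ℝ, ℂ)) :
    momentum u = fourierMultiplierCLM ℂ (fun x : ℝ => ((2 * Real.pi * x : ℝ) : ℂ)) u := by
  show (-Complex.I) • ∂_{(1 : ℝ)} u = _
  have e : (fun x : ℝ => ((2 * Real.pi * x : ℝ) : ℂ)) =
      (2 * Real.pi : ℂ) • (fun x : ℝ => ((inner ℝ x (1 : ℝ) : ℝ) : ℂ)) := by
    funext x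
    simp
  have hg : (fun x : ℝ => ((inner ℝ x (1 : ℝ) : ℝ) : ℂ)).HasTemperateGrowth := by fun_prop
  rw [lineDeriv_eq_fourierMultiplierCLM, e, fourierMultiplierCLM_smul hg,
    smul_smul]
  rw [smul_apply]
  congr 1
  linear_combination (-(2 * Real.pi : ℂ)) * Complex.I_mul_I

lemma fourierMultiplierCLM_sub_apply {g h : ℝ → ℂ} (hg : g.HasTemperateGrowth)
    (hh : h.HasTemperateGrowth) (u : 𝓢'(ℝ, ℂ)) :
    fourierMultiplierCLM ℂ (g - h) u = fourierMultiplierCLM ℂ g u - fourierMultiplierCLM ℂ h u := by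
  rw [fourierMultiplierCLM_apply, smulLeftCLM_sub hg hh, sub_apply]
  exact map_sub (fourierInvCLM ℂ 𝓢'(ℝ, ℂ)) _ _

lemma momentum_cube_sub (z : ℂ) (u : 𝓢'(ℝ, ℂ)) :
    (momentum ^ 3) u - z • u = fourierMultiplierCLM ℂ (symb z) u := by
  have h : (fun x : ℝ => ((2 * Real.pi * x : ℝ) : ℂ)).HasTemperateGrowth :=
    Function.Complex.hasTemperateGrowth_ofReal.comp (by fun_prop : (fun x : ℝ => 2 * Real.pi * x).HasTemperateGrowth)
  have e : symb z = (fun x : ℝ => ((2 * Real.pi * x : ℝ) : ℂ)) * ((fun x : ℝ => ((2 * Real.pi * x : ℝ) : ℂ)) *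
      (fun x : ℝ => ((2 * Real.pi * x : ℝ) : ℂ))) - fun _ => z := by
    funext x
    simp only [symb, Pi.sub_apply, Pi.mul_apply]
    ring
  have h2 := h.mul (h.mul h)
  have e2 : (momentum ^ 3) u = momentum (momentum (momentum u)) := rfl
  rw [e2, momentum_eq, momentum_eq, momentum_eq,
    fourierMultiplierCLM_fourierMultiplierCLM_apply h h,
    fourierMultiplierCLM_fourierMultiplierCLM_apply h (h.mul h), e]
  rw [fourierMultiplierCLM_sub_apply h2 (.const z), fourierMultiplierCLM_const]
  rfl

/-- The free resolvent `(A - z)⁻¹`. -/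
def freeRes {z : ℂ} (hz : 0 < z.im) : L2 →L[ℂ] L2 :=
  ((Lp.fourierTransformₗᵢ ℝ ℂ).symm : L2 →L[ℂ] L2) ∘L
    ((ContinuousLinearMap.mul ℂ ℂ).holderL volume ∞ 2 2 ((memLp_inv_symb hz).toLp _)) ∘L
    ((Lp.fourierTransformₗᵢ ℝ ℂ) : L2 →L[ℂ] L2)

lemma toDist_freeRes {z : ℂ} (hz : 0 < z.im) (f : L2) :
    toDist (freeRes hz f) = fourierMultiplierCLM ℂ (fun x => (symb z x)⁻¹) (toDist f) := by
  have e : freeRes hz f = 𝓕⁻ (((memLp_inv_symb hz).toLp _ • (𝓕 f : L2) : L2)) := by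
    show (Lp.fourierTransformₗᵢ ℝ ℂ).symm _ = (Lp.fourierTransformₗᵢ ℝ ℂ).symm _
    congr 1
  rw [e, fourierMultiplierCLM_apply]
  show ((𝓕⁻ (((memLp_inv_symb hz).toLp _ • (𝓕 f : L2) : L2)) : L2) : 𝓢'(ℝ, ℂ)) = _
  rw [← Lp.fourierInv_toTemperedDistribution_eq, Lp.toTemperedDistribution_smul_eq
    (hasTemperateGrowth_inv_symb hz), ← Lp.fourier_toTemperedDistribution_eq]
  rfl

lemma toDist_A (u : A.domain) : toDist (A u) = (momentum ^ 3) (toDist (u : L2)) :=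
  (exists_momentum_cube u).choose_spec

/-- The symbol controls |x|³ up to |z|, so its inverse gains three derivatives; this puts the range
of `freeRes` inside `H3`. -/
lemma norm_inv_symb_mul_le {z : ℂ} (hz : 0 < z.im) (x : ℝ) :
    ‖(symb z x)⁻¹ * (((1 + ‖x‖ ^ 2) ^ ((3 : ℝ) / 2) : ℝ) : ℂ)‖ ≤ 4 * ((1 + ‖z‖) * z.im⁻¹ + 1) := by
  have h0 : 0 < ‖symb z x‖ := norm_pos_iff.mpr (symb_ne_zero hz x)
  have h1 : (1 + ‖x‖ ^ 2) ^ ((3 : ℝ) / 2) ≤ (1 + ‖x‖) ^ 3 := by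
    calc (1 + ‖x‖ ^ 2) ^ ((3 : ℝ) / 2) ≤ ((1 + ‖x‖) ^ 2) ^ ((3 : ℝ) / 2) := by
          gcongr
          nlinarith [norm_nonneg x]
      _ = (1 + ‖x‖) ^ 3 := by
          rw [← Real.rpow_natCast, ← Real.rpow_natCast, ← Real.rpow_mul (by positivity)]
          norm_num
  have h2 : ‖x‖ ^ 3 ≤ ‖symb z x‖ + ‖z‖ := by
    have e : ((2 * Real.pi * x : ℝ) : ℂ) ^ 3 = symb z x + z := by simp [symb]
    have h3 := norm_add_le (symb z x) z
    rw [← e, norm_pow, Complex.norm_real, norm_mul] at h3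
    refine le_trans ?_ h3
    gcongr
    have : 1 ≤ ‖2 * Real.pi‖ := by
      rw [Real.norm_of_nonneg (by positivity)]; linarith [Real.pi_gt_three]
    nlinarith [norm_nonneg x]
  have h3 : (1 + ‖x‖) ^ 3 ≤ 4 * (1 + ‖x‖ ^ 3) := by
    nlinarith [mul_nonneg (add_nonneg zero_le_one (norm_nonneg x)) (sq_nonneg (‖x‖ - 1))]
  rw [norm_mul, Complex.norm_real, Real.norm_of_nonneg (by positivity)]
  calc ‖(symb z x)⁻¹‖ * (1 + ‖x‖ ^ 2) ^ ((3 : ℝ) / 2)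
      ≤ ‖(symb z x)⁻¹‖ * (4 * (1 + (‖symb z x‖ + ‖z‖))) := by
        gcongr
        linarith
    _ = 4 * ((1 + ‖z‖) * ‖(symb z x)⁻¹‖ + ‖(symb z x)⁻¹‖ * ‖symb z x‖) := by ring
    _ ≤ 4 * ((1 + ‖z‖) * z.im⁻¹ + 1) := by
        gcongr
        · exact norm_inv_symb_le hz x
        · rw [norm_inv, inv_mul_cancel₀ h0.ne']

lemma freeRes_mem {z : ℂ} (hz : 0 < z.im) (f : L2) : freeRes hz f ∈ H3 := by
  show TemperedDistribution.MemSobolev 3 2 (toDist (freeRes hz f))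
  have h := memSobolev_besselPotential_iff (s := 0) (r := 3) (p := 2) (f := toDist (freeRes hz f))
  rw [add_zero] at h
  rw [← h, toDist_freeRes, besselPotential, fourierMultiplierCLM_fourierMultiplierCLM_apply
    (hasTemperateGrowth_inv_symb hz) (by fun_prop)]
  refine MemSobolev.fourierMultiplierCLM_of_bounded (memSobolev_zero_iff.mpr ⟨f, rfl⟩) ?_ ?_
  · exact (hasTemperateGrowth_inv_symb hz).mul (by fun_prop)
  · exact ⟨_, norm_inv_symb_mul_le hz⟩

lemma multiplier_symb_cancel {z : ℂ} (hz : 0 < z.im) (u : 𝓢'(ℝ, ℂ)) :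
    fourierMultiplierCLM ℂ (symb z) (fourierMultiplierCLM ℂ (fun x => (symb z x)⁻¹) u) = u ∧
    fourierMultiplierCLM ℂ (fun x => (symb z x)⁻¹) (fourierMultiplierCLM ℂ (symb z) u) = u := by
  have h1 := hasTemperateGrowth_symb z
  have h2 := hasTemperateGrowth_inv_symb hz
  have e : (fun x => (symb z x)⁻¹) * symb z = fun _ => 1 := by
    funext x; simp [symb_ne_zero hz x]
  rw [fourierMultiplierCLM_fourierMultiplierCLM_apply h1 h2,
    fourierMultiplierCLM_fourierMultiplierCLM_apply h2 h1, mul_comm (symb z), e,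
    fourierMultiplierCLM_const]
  simp

lemma isResolvent_freeRes {z : ℂ} (hz : 0 < z.im) : IsResolvent A z (freeRes hz) := by
  constructor
  · refine fun f => ⟨freeRes_mem hz f, toDist_injective ?_⟩
    rw [map_sub, map_smul, toDist_A, momentum_cube_sub, toDist_freeRes]
    exact (multiplier_symb_cancel hz _).1
  · intro u
    refine toDist_injective ?_
    rw [toDist_freeRes, map_sub, map_smul]
    rw [toDist_A u]
    rw [momentum_cube_sub]
    exact (multiplier_symb_cancel hz _).2

/-- The resolvent is moved onto the test function: ψ is the transposed resolvent of φ. This lets the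
integral kernel be checked on Schwartz functions, with no inverse Fourier transform to compute. -/
lemma exists_transposed_solution {z : ℂ} (hz : 0 < z.im) (φ : 𝓢(ℝ, ℂ)) :
    ∃ ψ : 𝓢(ℝ, ℂ), (∀ x, -Complex.I * (∂_{(1 : ℝ)} (∂_{(1 : ℝ)} (∂_{(1 : ℝ)} ψ))) x - z * ψ x = φ x) ∧
      ∀ f : L2, ∫ x, φ x • freeRes hz f x = ∫ x, ψ x • f x := by
  set ψ : 𝓢(ℝ, ℂ) := 𝓕 (SchwartzMap.smulLeftCLM ℂ (fun x => (symb z x)⁻¹) (𝓕⁻ φ)) with hψ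
  have key : ∀ u : 𝓢'(ℝ, ℂ), fourierMultiplierCLM ℂ (fun x => (symb z x)⁻¹) u φ = u ψ := fun u => by
    rw [fourierMultiplierCLM_apply_apply]
  refine ⟨ψ, fun x => ?_, fun f => ?_⟩
  -- Testing the multiplier identity on a delta at x yields the differential equation pointwise.
  · have h1 := key (fourierMultiplierCLM ℂ (symb z) (delta x))
    rw [(multiplier_symb_cancel hz _).2, ← momentum_cube_sub] at h1
    have e2 : (momentum ^ 3) (delta x) = momentum (momentum (momentum (delta x))) := rfl
    have e3 : ∀ (u : 𝓢'(ℝ, ℂ)) (g : 𝓢(ℝ, ℂ)), momentum u g = Complex.I * u (∂_{(1 : ℝ)} g) := by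
      intro u g
      show ((-Complex.I) • ∂_{(1 : ℝ)} u) g = _
      simp
    have e4 : ((momentum ^ 3) (delta x) - z • delta x) ψ
        = (momentum ^ 3) (delta x) ψ - z * delta x ψ := rfl
    rw [e4, e2, e3, e3, e3] at h1
    simp only [delta_apply] at h1
    rw [h1]
    linear_combination (-Complex.I * (∂_{(1 : ℝ)} (∂_{(1 : ℝ)} (∂_{(1 : ℝ)} ψ))) x) * Complex.I_sq
  · have h1 := key (toDist f)
    rw [← toDist_freeRes] at h1
    have e : ∀ (g : L2) (χ : 𝓢(ℝ, ℂ)), toDist g χ = ∫ x, χ x • g x := fun g χ =>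
      Lp.toTemperedDistribution_apply g χ
    rwa [e, e] at h1

end FreeResolvent

/-! ### The profile of the free resolvent kernel -/

noncomputable section Profile

/-- The primitive cube root of unity `e^{2πi/3}`. -/
def om : ℂ := ⟨-1 / 2, Real.sqrt 3 / 2⟩

lemma om_sq_add : om ^ 2 + om + 1 = 0 := by
  have h : Real.sqrt 3 * Real.sqrt 3 = 3 := Real.mul_self_sqrt (by norm_num)
  apply Complex.ext <;> simp [om, pow_two] <;> ring_nf
  nlinarith

lemma om_cube : om ^ 3 = 1 := by linear_combination (om - 1) * om_sq_add

lemma norm_om : ‖om‖ = 1 := by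
  have h : ‖om‖ ^ 3 = 1 := by rw [← norm_pow, om_cube, norm_one]
  exact (pow_eq_one_iff_of_nonneg (norm_nonneg _) three_ne_zero).mp h

/-- The parameters `lam` for which `e^{lam t}` decays as `t → -∞`, while `e^{om lam t}` and
`e^{om² lam t}` decay as `t → ∞`. -/
structure Adm (lam : ℂ) : Prop where
  re_pos : 0 < lam.re
  re_om : (om * lam).re < 0
  re_om_sq : (om ^ 2 * lam).re < 0

lemma Adm.ne_zero {lam : ℂ} (h : Adm lam) : lam ≠ 0 := by
  rintro rfl
  exact lt_irrefl _ h.re_pos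

/-- The function `e^{lam t}` for `t ≤ 0` and `-(a e^{om lam t} + b e^{om² lam t})` for `t > 0`. -/
def glue (a b lam : ℂ) (t : ℝ) : ℂ :=
  if t ≤ 0 then Complex.exp (lam * t)
  else -(a * Complex.exp (om * lam * t) + b * Complex.exp (om ^ 2 * lam * t))

/-- Up to a constant factor, the convolution kernel of the free resolvent. -/
def prof (lam : ℂ) : ℝ → ℂ := glue om (om ^ 2) lam

/-- The condition a + b = -1 matches the two branches at 0; the min/max form makes continuity and
Lipschitz bounds direct. -/
lemma glue_eq_add {a b lam : ℂ} (hab : a + b = -1) (t : ℝ) :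
    glue a b lam t = Complex.exp (lam * (min t 0 : ℝ)) -
      (a * Complex.exp (om * lam * (max t 0 : ℝ)) + b * Complex.exp (om ^ 2 * lam * (max t 0 : ℝ)))
        - 1 := by
  rw [glue]
  split_ifs with h
  · rw [min_eq_left h, max_eq_right h]
    simp
    linear_combination hab
  · push Not at h
    rw [min_eq_right h.le, max_eq_left h.le]
    simp

lemma continuous_glue {a b lam : ℂ} (hab : a + b = -1) : Continuous (glue a b lam) := by
  have : glue a b lam = fun t : ℝ => Complex.exp (lam * (min t 0 : ℝ)) -
      (a * Complex.exp (om * lam * (max t 0 : ℝ)) + b * Complex.exp (om ^ 2 * lam * (max t 0 : ℝ)))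
        - 1 := funext (glue_eq_add hab)
  rw [this]
  fun_prop

lemma norm_exp_sub_exp_le {x y : ℂ} (hx : x.re ≤ 0) (hy : y.re ≤ 0) :
    ‖Complex.exp x - Complex.exp y‖ ≤ ‖x - y‖ := by
  have h := Convex.norm_image_sub_le_of_norm_hasDerivWithin_le (𝕜 := ℂ) (f := Complex.exp)
    (f' := Complex.exp) (C := 1) (s := {w : ℂ | w.re ≤ 0}) (x := y) (y := x)
    (fun w _ => (Complex.hasDerivAt_exp w).hasDerivWithinAt)
    (fun w hw => by rw [Complex.norm_exp]; exact Real.exp_le_one_iff.mpr hw)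
    (convex_halfSpace_re_le 0) hy hx
  simpa using h

lemma norm_exp_mul_sub_le {μ : ℂ} {a b : ℝ} (ha : (μ * a).re ≤ 0) (hb : (μ * b).re ≤ 0) :
    ‖Complex.exp (μ * a) - Complex.exp (μ * b)‖ ≤ ‖μ‖ * |a - b| := by
  refine (norm_exp_sub_exp_le ha hb).trans ?_
  rw [← mul_sub, norm_mul, ← Complex.ofReal_sub, Complex.norm_real, Real.norm_eq_abs]

/-- All exponents stay in the closed left half-plane, where exp is 1-Lipschitz. General a, b are
kept because the derivative of `prof` has the two coefficients exchanged. -/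
lemma norm_glue_sub_le {a b lam : ℂ} (h : Adm lam) (hab : a + b = -1) (ha : ‖a‖ = 1) (hb : ‖b‖ = 1)
    (t u : ℝ) : ‖glue a b lam t - glue a b lam u‖ ≤ 2 * ‖lam‖ * |t - u| := by
  have neg : ∀ (μ : ℂ) (v : ℝ), 0 ≤ μ.re → (μ * (min v 0 : ℝ)).re ≤ 0 := fun μ v hμ => by
    rw [Complex.re_mul_ofReal]; exact mul_nonpos_of_nonneg_of_nonpos hμ (min_le_right _ _)
  have pos : ∀ (μ : ℂ) (v : ℝ), μ.re ≤ 0 → (μ * (max v 0 : ℝ)).re ≤ 0 := fun μ v hμ => by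
    rw [Complex.re_mul_ofReal]; exact mul_nonpos_of_nonpos_of_nonneg hμ (le_max_right _ _)
  have h1 := norm_exp_mul_sub_le (neg lam t h.re_pos.le) (neg lam u h.re_pos.le)
  have h2 := norm_exp_mul_sub_le (pos _ t h.re_om.le) (pos _ u h.re_om.le)
  have h3 := norm_exp_mul_sub_le (pos _ t h.re_om_sq.le) (pos _ u h.re_om_sq.le)
  rw [norm_mul, norm_om, one_mul] at h2
  rw [norm_mul, norm_pow, norm_om, one_pow, one_mul] at h3
  rw [glue_eq_add hab, glue_eq_add hab]
  have e : |min t 0 - min u 0| + |max t 0 - max u 0| = |t - u| := by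
    rcases le_total t 0 with ht | ht <;> rcases le_total u 0 with hu | hu <;>
      simp only [ht, hu, min_eq_left, min_eq_right, max_eq_left, max_eq_right] <;> grind
  set X := Complex.exp (lam * (min t 0 : ℝ)) - Complex.exp (lam * (min u 0 : ℝ))
  set Y := Complex.exp (om * lam * (max t 0 : ℝ)) - Complex.exp (om * lam * (max u 0 : ℝ))
  set Z := Complex.exp (om ^ 2 * lam * (max t 0 : ℝ)) - Complex.exp (om ^ 2 * lam * (max u 0 : ℝ))
  calc _ = ‖X - (a * Y + b * Z)‖ := by congr 1; simp only [X, Y, Z]; ring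
    _ ≤ ‖X‖ + (‖Y‖ + ‖Z‖) := by
        refine (norm_sub_le _ _).trans (add_le_add_right ((norm_add_le _ _).trans ?_) _)
        rw [norm_mul, norm_mul, ha, hb, one_mul, one_mul]
    _ ≤ ‖lam‖ * |min t 0 - min u 0| + (‖lam‖ * |max t 0 - max u 0| + ‖lam‖ * |max t 0 - max u 0|) := by
        gcongr
    _ ≤ 2 * ‖lam‖ * |t - u| := by
        rw [← e]
        nlinarith [mul_nonneg (norm_nonneg lam) (abs_nonneg (min t 0 - min u 0))]

lemma om_add_sq : om + om ^ 2 = -1 := by linear_combination om_sq_add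

lemma norm_om_sq : ‖om ^ 2‖ = 1 := by rw [norm_pow, norm_om, one_pow]

lemma continuous_prof (lam : ℂ) : Continuous (prof lam) := continuous_glue om_add_sq

lemma prof_zero (lam : ℂ) : prof lam 0 = 1 := by simp [prof, glue]

lemma norm_prof_sub_le {lam : ℂ} (h : Adm lam) (t u : ℝ) :
    ‖prof lam t - prof lam u‖ ≤ 2 * ‖lam‖ * |t - u| :=
  norm_glue_sub_le h om_add_sq norm_om norm_om_sq t u

lemma norm_exp_mul_le_one {μ : ℂ} {t : ℝ} (h : μ.re * t ≤ 0) : ‖Complex.exp (μ * t)‖ ≤ 1 := by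
  rw [Complex.norm_exp, Complex.re_mul_ofReal]
  exact Real.exp_le_one_iff.mpr h

lemma norm_prof_le {lam : ℂ} (h : Adm lam) (t : ℝ) : ‖prof lam t‖ ≤ 2 := by
  rw [prof, glue]
  split_ifs with ht
  · exact (norm_exp_mul_le_one (mul_nonpos_of_nonneg_of_nonpos h.re_pos.le ht)).trans one_le_two
  · push Not at ht
    rw [norm_neg]
    refine (norm_add_le _ _).trans ?_
    rw [norm_mul, norm_mul, norm_om_sq, norm_om]
    have h1 := norm_exp_mul_le_one (mul_nonpos_of_nonpos_of_nonneg h.re_om.le ht.le)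
    have h2 := norm_exp_mul_le_one (mul_nonpos_of_nonpos_of_nonneg h.re_om_sq.le ht.le)
    linarith

lemma hasDerivAt_exp_mul (μ : ℂ) (t : ℝ) :
    HasDerivAt (fun t : ℝ => Complex.exp (μ * t)) (μ * Complex.exp (μ * t)) t := by
  have h : HasDerivAt (fun t : ℝ => μ * (t : ℂ)) (μ * 1) t :=
    (HasDerivAt.ofReal_comp (hasDerivAt_id t)).const_mul μ
  have := h.cexp
  rwa [mul_one, mul_comm] at this

/-- Differentiation multiplies the coefficients ω, ω² by ω, ω², giving ω², ω⁴ = ω. The one-sided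
formulas agree at 0, so the derivative exists there too. -/
lemma hasDerivAt_prof {lam : ℂ} (t : ℝ) :
    HasDerivAt (prof lam) (lam * glue (om ^ 2) om lam t) t := by
  have hne : ∀ u : ℝ, u ≠ 0 → HasDerivAt (prof lam) (lam * glue (om ^ 2) om lam u) u := by
    intro u hu
    rcases lt_or_gt_of_ne hu with hu | hu
    · rw [glue, if_pos hu.le]
      refine (hasDerivAt_exp_mul lam u).congr_of_eventuallyEq ?_
      filter_upwards [eventually_lt_nhds hu] with v hv
      rw [prof, glue, if_pos hv.le]
    · rw [glue, if_neg (not_le.mpr hu)]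
      have h := (((hasDerivAt_exp_mul (om * lam) u).const_mul om).add
        ((hasDerivAt_exp_mul (om ^ 2 * lam) u).const_mul (om ^ 2))).neg
      have e : -(om * (om * lam * Complex.exp (om * lam * u)) +
          om ^ 2 * (om ^ 2 * lam * Complex.exp (om ^ 2 * lam * u))) =
          lam * -(om ^ 2 * Complex.exp (om * lam * u) + om * Complex.exp (om ^ 2 * lam * u)) := by
        linear_combination (-om * lam * Complex.exp (om ^ 2 * lam * u)) * om_cube
      rw [e] at h
      refine h.congr_of_eventuallyEq ?_
      filter_upwards [eventually_gt_nhds hu] with v hv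
      rw [prof, glue, if_neg (not_le.mpr hv)]
      rfl
  by_cases ht : t = 0
  · subst ht
    refine hasDerivAt_of_hasDerivAt_of_ne hne (continuous_prof lam).continuousAt ?_
    exact (continuous_const.mul (continuous_glue (by rw [add_comm]; exact om_add_sq))).continuousAt
  · exact hne t ht

lemma norm_second_difference_le {lam : ℂ} (h : Adm lam) (x y : ℝ) :
    ‖prof lam (x + y) - prof lam x - prof lam y + 1‖ ≤ 2 * ‖lam‖ ^ 2 * |x| * |y| := by
  have hd : ∀ t ∈ (Set.univ : Set ℝ), HasDerivWithinAt (fun t => prof lam (t + y) - prof lam t)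
      (lam * glue (om ^ 2) om lam (t + y) - lam * glue (om ^ 2) om lam t) Set.univ t := fun t _ =>
    (((hasDerivAt_prof (lam := lam) (t + y)).comp_add_const t y).sub
      (hasDerivAt_prof t)).hasDerivWithinAt
  have hb : ∀ t ∈ (Set.univ : Set ℝ),
      ‖lam * glue (om ^ 2) om lam (t + y) - lam * glue (om ^ 2) om lam t‖
        ≤ 2 * ‖lam‖ ^ 2 * |y| := fun t _ => by
    have h1 := norm_glue_sub_le h (by rw [add_comm]; exact om_add_sq) norm_om_sq norm_om (t + y) t
    rw [add_sub_cancel_left] at h1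
    rw [← mul_sub, norm_mul]
    calc _ ≤ ‖lam‖ * (2 * ‖lam‖ * |y|) := by gcongr
      _ = _ := by ring
  have := Convex.norm_image_sub_le_of_norm_hasDerivWithin_le hd hb convex_univ
    (Set.mem_univ (0 : ℝ)) (Set.mem_univ x)
  simp only [zero_add, prof_zero, sub_zero, Real.norm_eq_abs] at this
  calc _ = ‖prof lam (x + y) - prof lam x - (prof lam y - 1)‖ := by congr 1; ring
    _ ≤ _ := this
    _ = _ := by ring

/-- The constant factor in the kernel of the free resolvent. -/
def kap (lam : ℂ) : ℂ := Complex.I / (3 * lam ^ 2)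

/-- The kernel of the regular part of the free resolvent. -/
def regKer (lam : ℂ) (x y : ℝ) : ℂ :=
  kap lam * (prof lam (x - y) - prof lam x * prof lam (-y))

/-- prof(x - y) - prof(x)prof(-y) is the second difference minus (prof(x) - 1)(prof(-y) - 1). Both
are O(|λ|²|x||y|), with constants 2 and 4, cancelling the factor 1/(3|λ|²). -/
lemma norm_regKer_le {lam : ℂ} (h : Adm lam) (x y : ℝ) : ‖regKer lam x y‖ ≤ 2 * |x| * |y| := by
  have h1 := norm_second_difference_le h x (-y)
  rw [abs_neg, ← sub_eq_add_neg] at h1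
  have h2 : ‖(prof lam x - 1) * (prof lam (-y) - 1)‖ ≤ (2 * ‖lam‖ * |x|) * (2 * ‖lam‖ * |y|) := by
    rw [norm_mul]
    have a := norm_prof_sub_le h x 0
    have b := norm_prof_sub_le h (-y) 0
    rw [prof_zero, sub_zero] at a b
    rw [abs_neg] at b
    gcongr
  have hl : 0 < ‖lam‖ := norm_pos_iff.mpr h.ne_zero
  rw [regKer, norm_mul, kap, norm_div, Complex.norm_I, norm_mul, norm_pow, Complex.norm_ofNat]
  have h3 : ‖prof lam (x - y) - prof lam x * prof lam (-y)‖ ≤ 6 * ‖lam‖ ^ 2 * |x| * |y| := by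
    calc _ = ‖(prof lam (x - y) - prof lam x - prof lam (-y) + 1)
          - (prof lam x - 1) * (prof lam (-y) - 1)‖ := by congr 1; ring
      _ ≤ _ := norm_sub_le _ _
      _ ≤ _ := add_le_add h1 h2
      _ = _ := by ring
  calc _ ≤ 1 / (3 * ‖lam‖ ^ 2) * (6 * ‖lam‖ ^ 2 * |x| * |y|) := by gcongr
    _ = _ := by field_simp; ring

/-- Half the square of the positive part, times `-i`: a fundamental solution of `(-i∂)³`. -/
def fundSol (t : ℝ) : ℂ := -(Complex.I / 2) * ((max t 0 : ℝ) : ℂ) ^ 2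

/-- The limit of the regular kernel as `lam → 0`. -/
def limKer (x y : ℝ) : ℂ := fundSol (x - y) - fundSol x - fundSol (-y)

/-! ### Second-order asymptotics of the profile -/

lemma tendsto_exp_remainder (c : ℂ) :
    Tendsto (fun l : ℂ => (Complex.exp (l * c) - 1 - l * c) / l ^ 2) (𝓝[≠] 0) (𝓝 (c ^ 2 / 2)) := by
  rw [tendsto_iff_norm_sub_tendsto_zero]
  have h0 : Tendsto (fun l : ℂ => ‖l‖ * ‖c‖ ^ 3) (𝓝[≠] 0) (𝓝 0) := by
    have : Continuous fun l : ℂ => ‖l‖ * ‖c‖ ^ 3 := by fun_prop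
    have h := (this.tendsto 0).mono_left (nhdsWithin_le_nhds (s := {0}ᶜ))
    simpa using h
  refine squeeze_zero' (Eventually.of_forall fun _ => norm_nonneg _) ?_ h0
  have h1 : ∀ᶠ l : ℂ in 𝓝[≠] 0, ‖l * c‖ ≤ 1 := by
    refine nhdsWithin_le_nhds ?_
    have : Continuous fun l : ℂ => ‖l * c‖ := by fun_prop
    exact (this.tendsto 0).eventually (by simpa using eventually_le_nhds (zero_lt_one (α := ℝ)))
  filter_upwards [h1, self_mem_nhdsWithin] with l hl hl0
  have hl0 : l ≠ 0 := hl0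
  have hb := Complex.exp_bound hl (n := 3) (by norm_num)
  have e : (Complex.exp (l * c) - 1 - l * c) / l ^ 2 - c ^ 2 / 2 =
      (Complex.exp (l * c) - ∑ m ∈ Finset.range 3, (l * c) ^ m / (m.factorial : ℂ)) / l ^ 2 := by
    simp [Finset.sum_range_succ, Nat.factorial]
    field_simp
    ring
  rw [e, norm_div, norm_pow, div_le_iff₀ (by positivity)]
  refine hb.trans ?_
  norm_num [Nat.factorial]
  nlinarith [mul_nonneg (norm_nonneg l) (norm_nonneg c), pow_nonneg (mul_nonneg (norm_nonneg l) (norm_nonneg c)) 3]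

/-- Both branches begin with 1 + λt, since -(ω + ω²) = -(ω² + ω⁴) = 1. They differ first at order
λ²: coefficient t²/2 on the left and -t² on the right. -/
lemma tendsto_prof_remainder (t : ℝ) :
    Tendsto (fun l : ℂ => (prof l t - 1 - l * t) / l ^ 2) (𝓝[≠] 0)
      (𝓝 ((t : ℂ) ^ 2 / 2 - 3 / 2 * ((max t 0 : ℝ) : ℂ) ^ 2)) := by
  rcases le_or_gt t 0 with ht | ht
  · rw [max_eq_right ht]
    simp only [prof, glue, if_pos ht]
    simpa using tendsto_exp_remainder t
  · rw [max_eq_left ht.le]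
    simp only [prof, glue, if_neg (not_le.mpr ht)]
    have h := (((tendsto_exp_remainder (om * t)).const_mul om).add
      ((tendsto_exp_remainder (om ^ 2 * t)).const_mul (om ^ 2))).neg
    have e : -(om * ((om * (t : ℂ)) ^ 2 / 2) + om ^ 2 * ((om ^ 2 * t) ^ 2 / 2))
        = (t : ℂ) ^ 2 / 2 - 3 / 2 * (t : ℂ) ^ 2 := by
      linear_combination (-((t : ℂ) ^ 2) / 2 * (om ^ 3 + 2)) * om_cube
    rw [e] at h
    refine h.congr' ?_
    filter_upwards [self_mem_nhdsWithin] with l hl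
    have hl : l ≠ 0 := hl
    have e1 : l * (om * (t : ℂ)) = om * l * t := by ring
    have e2 : l * (om ^ 2 * (t : ℂ)) = om ^ 2 * l * t := by ring
    rw [e1, e2]
    field_simp
    linear_combination (1 + l * (t : ℂ) * (1 + om * (om - 1))) * om_sq_add

lemma tendsto_prof (t : ℝ) : Tendsto (fun l : ℂ => prof l t) (𝓝[≠] 0) (𝓝 1) := by
  have hl : Tendsto (fun l : ℂ => l) (𝓝[≠] (0 : ℂ)) (𝓝 0) := nhdsWithin_le_nhds
  have h := (((hl.pow 2).mul (tendsto_prof_remainder t)).add (hl.mul_const (t : ℂ))).add_const 1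
  simp only [ne_eq, OfNat.ofNat_ne_zero, not_false_eq_true, zero_pow, zero_mul, zero_add] at h
  refine h.congr' ?_
  filter_upwards [self_mem_nhdsWithin] with l hl
  have hl : l ≠ 0 := hl
  field_simp
  ring

lemma tendsto_regKer (x y : ℝ) :
    Tendsto (fun l : ℂ => regKer l x y) (𝓝[≠] 0) (𝓝 (limKer x y)) := by
  have hl : Tendsto (fun l : ℂ => l) (𝓝[≠] (0 : ℂ)) (𝓝 0) := nhdsWithin_le_nhds
  have hx := tendsto_prof_remainder x
  have hy := tendsto_prof_remainder (-y)
  have hxy := tendsto_prof_remainder (x - y)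
  -- With r(t) = (prof(t) - 1 - λt)/λ², the kernel is (i/3)(r(x-y) - r(x)prof(-y) - (1+λx)r(-y) +
  -- xy). In the limit the plain quadratic terms cancel and only the positive parts survive.
  have h := (((hxy.sub (hx.mul (tendsto_prof (-y)))).sub
    (((hl.mul_const (x : ℂ)).const_add 1).mul hy)).add_const ((x : ℂ) * y)).const_mul
      (Complex.I / 3)
  have e : Complex.I / 3 * (((x - y : ℝ) : ℂ) ^ 2 / 2 - 3 / 2 * ((max (x - y) 0 : ℝ) : ℂ) ^ 2 -
      ((x : ℂ) ^ 2 / 2 - 3 / 2 * ((max x 0 : ℝ) : ℂ) ^ 2) * 1 -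
      (1 + 0 * (x : ℂ)) * (((-y : ℝ) : ℂ) ^ 2 / 2 - 3 / 2 * ((max (-y) 0 : ℝ) : ℂ) ^ 2) + x * y)
      = limKer x y := by
    simp only [limKer, fundSol]
    push_cast
    ring
  rw [e] at h
  refine h.congr' ?_
  filter_upwards [self_mem_nhdsWithin] with l hl
  have hl : l ≠ 0 := hl
  rw [regKer, kap]
  push_cast
  field_simp
  ring

end Profile

/-! ### The integral kernel of the free resolvent -/

noncomputable section FreeKernel

lemma hasDerivAt_schwartz (ψ : 𝓢(ℝ, ℂ)) (x : ℝ) : HasDerivAt ψ ((∂_{(1 : ℝ)} ψ) x) x := by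
  have h := (ψ.differentiable x).hasDerivAt
  rwa [← fderiv_apply_one_eq_deriv, ← SchwartzMap.lineDerivOp_apply_eq_fderiv] at h

/-- For `ψ''' + μ³ ψ` the function `e^{μ (x - y)} (ψ'' - μ ψ' + μ² ψ)` is a primitive of
`e^{μ (x - y)} (ψ''' + μ³ ψ)`. -/
def bdry (μ : ℂ) (ψ : 𝓢(ℝ, ℂ)) : 𝓢(ℝ, ℂ) :=
  ∂_{(1 : ℝ)} (∂_{(1 : ℝ)} ψ) - μ • ∂_{(1 : ℝ)} ψ + μ ^ 2 • ψ

lemma bdry_apply (μ : ℂ) (ψ : 𝓢(ℝ, ℂ)) (x : ℝ) : bdry μ ψ x =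
    (∂_{(1 : ℝ)} (∂_{(1 : ℝ)} ψ)) x - μ * (∂_{(1 : ℝ)} ψ) x + μ ^ 2 * ψ x := rfl

lemma hasDerivAt_exp_mul_bdry (μ : ℂ) (ψ : 𝓢(ℝ, ℂ)) (y x : ℝ) :
    HasDerivAt (fun x : ℝ => Complex.exp (μ * ((x - y : ℝ) : ℂ)) * bdry μ ψ x)
      (Complex.exp (μ * ((x - y : ℝ) : ℂ)) *
        ((∂_{(1 : ℝ)} (∂_{(1 : ℝ)} (∂_{(1 : ℝ)} ψ))) x + μ ^ 3 * ψ x)) x := by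
  have h1 := (hasDerivAt_exp_mul μ (x - y)).comp_sub_const x y
  have h2 : HasDerivAt (bdry μ ψ) ((∂_{(1 : ℝ)} (∂_{(1 : ℝ)} (∂_{(1 : ℝ)} ψ))) x
      - μ * (∂_{(1 : ℝ)} (∂_{(1 : ℝ)} ψ)) x + μ ^ 2 * (∂_{(1 : ℝ)} ψ) x) x :=
    ((hasDerivAt_schwartz _ x).sub ((hasDerivAt_schwartz _ x).const_mul μ)).add
      ((hasDerivAt_schwartz _ x).const_mul (μ ^ 2))
  convert! h1.mul h2 using 1
  rw [bdry_apply]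
  ring

lemma integrable_bdd_mul_schwartz {g : ℝ → ℂ} (hg : Continuous g) {s : Set ℝ}
    (hs : MeasurableSet s) (hb : ∀ x ∈ s, ‖g x‖ ≤ 1) (χ : 𝓢(ℝ, ℂ)) :
    IntegrableOn (fun x => g x * χ x) s := by
  refine (χ.integrable (μ := volume)).integrableOn.bdd_mul (c := 1) hg.aestronglyMeasurable ?_
  exact (ae_restrict_iff' hs).mpr (Eventually.of_forall hb)

lemma tendsto_bdd_mul_schwartz {g : ℝ → ℂ} {l : Filter ℝ} (hl : l ≤ cocompact ℝ)
    (hb : ∀ᶠ x in l, ‖g x‖ ≤ 1) (χ : 𝓢(ℝ, ℂ)) : Tendsto (fun x => g x * χ x) l (𝓝 0) := by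
  have h := (χ.tendsto_cocompact.mono_left hl).norm
  rw [norm_zero] at h
  refine squeeze_zero_norm' ?_ h
  filter_upwards [hb] with x hx
  rw [norm_mul]
  exact mul_le_of_le_one_left (norm_nonneg _) hx

lemma integral_Ioi_exp_mul {μ : ℂ} (hμ : μ.re ≤ 0) (ψ : 𝓢(ℝ, ℂ)) (y : ℝ) :
    IntegrableOn (fun x : ℝ => Complex.exp (μ * ((x - y : ℝ) : ℂ)) *
      ((∂_{(1 : ℝ)} (∂_{(1 : ℝ)} (∂_{(1 : ℝ)} ψ))) x + μ ^ 3 * ψ x)) (Set.Ioi y) ∧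
    ∫ x in Set.Ioi y, Complex.exp (μ * ((x - y : ℝ) : ℂ)) *
      ((∂_{(1 : ℝ)} (∂_{(1 : ℝ)} (∂_{(1 : ℝ)} ψ))) x + μ ^ 3 * ψ x) = -bdry μ ψ y := by
  have hb : ∀ x ∈ Set.Ioi y, ‖Complex.exp (μ * ((x - y : ℝ) : ℂ))‖ ≤ 1 := fun x hx =>
    norm_exp_mul_le_one (mul_nonpos_of_nonpos_of_nonneg hμ (sub_nonneg.mpr (le_of_lt hx)))
  have hi := integrable_bdd_mul_schwartz (by fun_prop) measurableSet_Ioi hb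
    (∂_{(1 : ℝ)} (∂_{(1 : ℝ)} (∂_{(1 : ℝ)} ψ)) + μ ^ 3 • ψ)
  refine ⟨hi, ?_⟩
  rw [integral_Ioi_of_hasDerivAt_of_tendsto' (fun x _ => hasDerivAt_exp_mul_bdry μ ψ y x) hi
    (tendsto_bdd_mul_schwartz atTop_le_cocompact
      ((eventually_gt_atTop y).mono hb) (bdry μ ψ))]
  simp

lemma integral_Iic_exp_mul {μ : ℂ} (hμ : 0 ≤ μ.re) (ψ : 𝓢(ℝ, ℂ)) (y : ℝ) :
    IntegrableOn (fun x : ℝ => Complex.exp (μ * ((x - y : ℝ) : ℂ)) *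
      ((∂_{(1 : ℝ)} (∂_{(1 : ℝ)} (∂_{(1 : ℝ)} ψ))) x + μ ^ 3 * ψ x)) (Set.Iic y) ∧
    ∫ x in Set.Iic y, Complex.exp (μ * ((x - y : ℝ) : ℂ)) *
      ((∂_{(1 : ℝ)} (∂_{(1 : ℝ)} (∂_{(1 : ℝ)} ψ))) x + μ ^ 3 * ψ x) = bdry μ ψ y := by
  have hb : ∀ x ∈ Set.Iic y, ‖Complex.exp (μ * ((x - y : ℝ) : ℂ))‖ ≤ 1 := fun x hx =>
    norm_exp_mul_le_one (mul_nonpos_of_nonneg_of_nonpos hμ (sub_nonpos.mpr hx))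
  have hi := integrable_bdd_mul_schwartz (by fun_prop) measurableSet_Iic hb
    (∂_{(1 : ℝ)} (∂_{(1 : ℝ)} (∂_{(1 : ℝ)} ψ)) + μ ^ 3 • ψ)
  refine ⟨hi, ?_⟩
  rw [integral_Iic_of_hasDerivAt_of_tendsto' (fun x _ => hasDerivAt_exp_mul_bdry μ ψ y x) hi
    (tendsto_bdd_mul_schwartz atBot_le_cocompact
      ((eventually_le_atBot y).mono hb) (bdry μ ψ))]
  simp

/-- Each exponential piece integrates to a boundary term at y. Summed over the cube roots of unity,
the ψ'' and ψ' terms cancel and 3λ²ψ(y) remains, which explains the constant in `kap`. -/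
lemma integral_prof_mul {lam z : ℂ} (h : Adm lam) (hz : lam ^ 3 = -Complex.I * z) {ψ φ : 𝓢(ℝ, ℂ)}
    (hψ : ∀ x, -Complex.I * (∂_{(1 : ℝ)} (∂_{(1 : ℝ)} (∂_{(1 : ℝ)} ψ))) x - z * ψ x = φ x) (y : ℝ) :
    ∫ x, kap lam * prof lam (x - y) * φ x = ψ y := by
  set g : ℝ → ℂ := fun x => (∂_{(1 : ℝ)} (∂_{(1 : ℝ)} (∂_{(1 : ℝ)} ψ))) x + lam ^ 3 * ψ x with hg
  have hφ : ∀ x, φ x = -Complex.I * g x := fun x => by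
    rw [← hψ, hg]
    simp only
    rw [hz]
    linear_combination (-z * ψ x) * Complex.I_sq
  have c1 : (om * lam) ^ 3 = lam ^ 3 := by rw [mul_pow, om_cube, one_mul]
  have c2 : (om ^ 2 * lam) ^ 3 = lam ^ 3 := by
    linear_combination (lam ^ 3 * (om ^ 3 + 1)) * om_cube
  obtain ⟨i0, e0⟩ := integral_Iic_exp_mul h.re_pos.le ψ y
  obtain ⟨i1, e1⟩ := integral_Ioi_exp_mul h.re_om.le ψ y
  obtain ⟨i2, e2⟩ := integral_Ioi_exp_mul h.re_om_sq.le ψ y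
  rw [c1] at i1 e1
  rw [c2] at i2 e2
  have hl : ∀ x ∈ Set.Iic y, Complex.exp (lam * ((x - y : ℝ) : ℂ)) * g x = prof lam (x - y) * g x :=
    fun x hx => by rw [prof, glue, if_pos (sub_nonpos.mpr hx)]
  have hr : ∀ x ∈ Set.Ioi y, -(om * (Complex.exp (om * lam * ((x - y : ℝ) : ℂ)) * g x)
      + om ^ 2 * (Complex.exp (om ^ 2 * lam * ((x - y : ℝ) : ℂ)) * g x)) = prof lam (x - y) * g x :=
    fun x hx => by
      rw [prof, glue, if_neg (not_le.mpr (sub_pos.mpr hx))]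
      ring
  have ir : IntegrableOn (fun x => -(om * (Complex.exp (om * lam * ((x - y : ℝ) : ℂ)) * g x)
      + om ^ 2 * (Complex.exp (om ^ 2 * lam * ((x - y : ℝ) : ℂ)) * g x))) (Set.Ioi y) :=
    ((i1.const_mul om).add (i2.const_mul (om ^ 2))).neg
  have er : ∫ x in Set.Ioi y, -(om * (Complex.exp (om * lam * ((x - y : ℝ) : ℂ)) * g x)
      + om ^ 2 * (Complex.exp (om ^ 2 * lam * ((x - y : ℝ) : ℂ)) * g x)) =
      om * bdry (om * lam) ψ y + om ^ 2 * bdry (om ^ 2 * lam) ψ y := by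
    rw [integral_neg, integral_add (i1.const_mul om) (i2.const_mul (om ^ 2)), integral_const_mul,
      integral_const_mul, e1, e2]
    ring
  have hI : ∫ x, prof lam (x - y) * g x = 3 * lam ^ 2 * ψ y := by
    rw [← intervalIntegral.integral_Iic_add_Ioi (b := y)
      (i0.congr_fun hl measurableSet_Iic) (ir.congr_fun hr measurableSet_Ioi),
      ← setIntegral_congr_fun measurableSet_Iic hl, ← setIntegral_congr_fun measurableSet_Ioi hr,
      e0, er]
    simp only [bdry_apply]
    set a := (∂_{(1 : ℝ)} (∂_{(1 : ℝ)} ψ)) y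
    set b := (∂_{(1 : ℝ)} ψ) y
    linear_combination (a - lam * b * (1 + om * (om - 1))) * om_sq_add
      + (lam ^ 2 * ψ y * (om ^ 3 + 2)) * om_cube
  have e : ∀ x, kap lam * prof lam (x - y) * φ x
      = kap lam * -Complex.I * (prof lam (x - y) * g x) := fun x => by rw [hφ]; ring
  simp only [e]
  rw [integral_const_mul, hI, kap]
  have := h.ne_zero
  field_simp
  linear_combination (-ψ y) * Complex.I_sq

/-- Both sides are tested against smooth compactly supported functions; duality and Fubini reduce
the identity to `integral_prof_mul`. Integrability of f makes the kernel integral a bounded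
function. -/
lemma freeRes_ae_eq {lam z : ℂ} (h : Adm lam) (hz : lam ^ 3 = -Complex.I * z) (hz' : 0 < z.im)
    (f : L2) (hf : Integrable f) :
    freeRes hz' f =ᵐ[volume] fun x => ∫ y, kap lam * prof lam (x - y) * f y := by
  have hbd : ∀ t, ‖kap lam * prof lam t‖ ≤ ‖kap lam‖ * 2 := fun t => by
    rw [norm_mul]
    gcongr
    exact norm_prof_le h t
  have hcont : Continuous fun x : ℝ × ℝ => kap lam * prof lam (x.1 - x.2) :=
    continuous_const.mul ((continuous_prof lam).comp (by fun_prop))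
  have hw : MemLp (fun x => ∫ y, kap lam * prof lam (x - y) * f y) ∞ volume := by
    refine memLp_top_of_bound (C := ‖kap lam‖ * 2 * ∫ y, ‖f y‖) ?_ (Eventually.of_forall fun x => ?_)
    · exact (hcont.aestronglyMeasurable.mul (hf.1.comp_snd (μ := volume))).integral_prod_right'
    · rw [← integral_const_mul]
      refine norm_integral_le_of_norm_le (hf.norm.const_mul _) (Eventually.of_forall fun y => ?_)
      rw [norm_mul]
      gcongr
      exact hbd _
  refine ae_eq_of_integral_contDiff_smul_eq
    ((Lp.memLp (freeRes hz' f)).locallyIntegrable (by norm_num)) (hw.locallyIntegrable le_top)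
    fun g g_diff g_supp => ?_
  have hg₁ : HasCompactSupport (fun x => (g x : ℂ)) := g_supp.comp_left Complex.ofReal_zero
  have hg₂ : ContDiff ℝ (↑(⊤ : ℕ∞)) (fun x => (g x : ℂ)) := Complex.ofRealCLM.contDiff.comp g_diff
  set φ : 𝓢(ℝ, ℂ) := hg₁.toSchwartzMap hg₂ with hφ
  have hφg : ∀ x, φ x = g x := fun x => rfl
  obtain ⟨ψ, hψ, hψf⟩ := exists_transposed_solution hz' φ
  have e1 : ∀ u : ℝ → ℂ, ∫ x, g x • u x = ∫ x, φ x • u x := fun u => by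
    simp only [hφg, Complex.real_smul, smul_eq_mul]
  rw [e1, e1, hψf]
  have hint : Integrable (Function.uncurry fun x y => φ x * (kap lam * prof lam (x - y) * f y))
      (volume.prod volume) := by
    have h1 := ((φ.integrable (μ := volume)).mul_prod hf).bdd_mul (c := ‖kap lam‖ * 2)
      hcont.aestronglyMeasurable (Eventually.of_forall fun x => hbd _)
    refine h1.congr (Eventually.of_forall fun x => ?_)
    simp only [Function.uncurry]
    ring
  have e2 : ∀ x, φ x • ∫ y, kap lam * prof lam (x - y) * f y
      = ∫ y, φ x * (kap lam * prof lam (x - y) * f y) := fun x => by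
    rw [smul_eq_mul, integral_const_mul]
  simp only [e2]
  rw [integral_integral_swap hint]
  refine integral_congr_ae (Eventually.of_forall fun y => ?_)
  simp only
  rw [← integral_prof_mul h hz hψ y, smul_eq_mul, ← integral_mul_const]
  refine integral_congr_ae (Eventually.of_forall fun x => ?_)
  simp only
  ring

/-- The cube root of `-i z` with the smallest argument. -/
def root (z : ℂ) : ℂ := (-Complex.I * z) ^ ((1 : ℂ) / 3)

lemma root_cube (z : ℂ) : root z ^ 3 = -Complex.I * z := by
  rw [root, ← Complex.cpow_nat_mul]
  norm_num

/-- Re(-iz) = Im z > 0, so the argument of the root lies in (-π/6, π/6); rotation by ±2π/3 then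
lands in the open left half-plane. -/
lemma adm_root {z : ℂ} (hz : 0 < z.im) : Adm (root z) := by
  set w := -Complex.I * z with hw
  have hre : 0 < w.re := by simpa [hw] using hz
  have hw0 : w ≠ 0 := fun h => by rw [h] at hre; exact lt_irrefl _ hre
  obtain ⟨ha, hb⟩ := abs_lt.mp (Complex.abs_arg_lt_pi_div_two_iff.mpr (Or.inl hre))
  set α := w.arg / 3 with hα
  have hr : 0 < Real.exp (Real.log ‖w‖ / 3) := Real.exp_pos _
  set r := Real.exp (Real.log ‖w‖ / 3)
  have hroot : root z = r * (Real.cos α + Real.sin α * Complex.I) := by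
    rw [root, ← hw, Complex.cpow_def_of_ne_zero hw0, Complex.log]
    rw [Complex.ofReal_cos, Complex.ofReal_sin, ← Complex.exp_mul_I, Complex.ofReal_exp,
      ← Complex.exp_add]
    congr 1
    rw [hα]
    push_cast
    ring
  have hcos : Real.sqrt 3 / 2 < Real.cos α := by
    rw [← Real.cos_pi_div_six, ← Real.cos_abs α]
    refine Real.cos_lt_cos_of_nonneg_of_le_pi_div_two (abs_nonneg _) (by linarith [Real.pi_pos]) ?_
    rw [abs_lt]
    constructor <;> linarith
  have hsq := Real.sin_sq_add_cos_sq α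
  have h3 : Real.sqrt 3 * Real.sqrt 3 = 3 := Real.mul_self_sqrt (by norm_num)
  have h30 : 0 < Real.sqrt 3 := by positivity
  have hsin : |Real.sin α| < 1 / 2 := by
    refine abs_lt_of_sq_lt_sq ?_ (by norm_num)
    nlinarith
  obtain ⟨hs1, hs2⟩ := abs_lt.mp hsin
  have hom : om ^ 2 = ⟨-1 / 2, -(Real.sqrt 3 / 2)⟩ := by
    have : om ^ 2 = -1 - om := by linear_combination om_sq_add
    rw [this]
    apply Complex.ext <;> simp [om]
    norm_num
  generalize Real.cos α = c at *
  generalize Real.sin α = s at *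
  refine ⟨?_, ?_, ?_⟩
  · rw [hroot]
    simp
    exact mul_pos hr (by linarith)
  · rw [hroot]
    simp [om]
    nlinarith [mul_pos hr (show 0 < c + Real.sqrt 3 * s by nlinarith)]
  · rw [hroot, hom]
    simp
    nlinarith [mul_pos hr (show 0 < c - Real.sqrt 3 * s by nlinarith)]

lemma tendsto_root : Tendsto root (𝓝[{z : ℂ | 0 < z.im}] 0) (𝓝[≠] 0) := by
  refine tendsto_nhdsWithin_iff.mpr ⟨?_, ?_⟩
  · have h1 : Tendsto (fun z => ‖root z‖ ^ 3) (𝓝[{z : ℂ | 0 < z.im}] 0) (𝓝 0) := by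
      have e : (fun z => ‖root z‖ ^ 3) = fun z : ℂ => ‖z‖ := by
        funext z
        rw [← norm_pow, root_cube]
        simp
      rw [e]
      have := (continuous_norm.tendsto (0 : ℂ)).mono_left
        (nhdsWithin_le_nhds (s := {z : ℂ | 0 < z.im}))
      simpa using this
    have h2 := ((Real.continuous_rpow_const (q := (1 : ℝ) / 3) (by norm_num)).tendsto 0).comp h1
    rw [Real.zero_rpow (by norm_num)] at h2
    rw [tendsto_zero_iff_norm_tendsto_zero]
    refine h2.congr fun z => ?_
    simp only [Function.comp_apply]
    rw [← Real.rpow_natCast, ← Real.rpow_mul (norm_nonneg _)]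
    norm_num
  · filter_upwards [self_mem_nhdsWithin] with z hz
    exact (adm_root hz).ne_zero

end FreeKernel

/-! ### Solutions of the third order equation as solutions of an integral equation -/

noncomputable section Solutions

/-- The threefold primitive of `i h`, based at `-a`. -/
def prim3 (a : ℝ) (h : ℝ → ℂ) (x : ℝ) : ℂ :=
  (Complex.I / 2) * ∫ y in (-a)..x, ((x - y : ℝ) : ℂ) ^ 2 * h y

/-- The primitive of `x ↦ x ^ k h(x)` based at `-a`. -/
def moment (a : ℝ) (h : ℝ → ℂ) (k : ℕ) (x : ℝ) : ℂ := ∫ y in (-a)..x, (y : ℂ) ^ k * h y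

variable {a : ℝ} {h : ℝ → ℂ}

lemma intervalIntegrable_pow_mul (hi : Integrable h) (k : ℕ) (c d : ℝ) :
    IntervalIntegrable (fun y : ℝ => (y : ℂ) ^ k * h y) volume c d :=
  (hi.intervalIntegrable).continuousOn_mul (by fun_prop)

lemma prim3_eq_moment (hi : Integrable h) (x : ℝ) :
    prim3 a h x = (Complex.I / 2) *
      ((x : ℂ) ^ 2 * moment a h 0 x - 2 * x * moment a h 1 x + moment a h 2 x) := by
  have e : ∀ y : ℝ, ((x - y : ℝ) : ℂ) ^ 2 * h y = ((x : ℂ) ^ 2 * ((y : ℂ) ^ 0 * h y)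
      - 2 * x * ((y : ℂ) ^ 1 * h y)) + (y : ℂ) ^ 2 * h y := fun y => by
    push_cast; ring
  have h0 := intervalIntegrable_pow_mul hi 0 (-a) x
  have h1 := intervalIntegrable_pow_mul hi 1 (-a) x
  have h2 := intervalIntegrable_pow_mul hi 2 (-a) x
  rw [prim3]
  simp only [e]
  rw [intervalIntegral.integral_add ((h0.const_mul _).sub (h1.const_mul _)) h2,
    intervalIntegral.integral_sub (h0.const_mul _) (h1.const_mul _),
    intervalIntegral.integral_const_mul, intervalIntegral.integral_const_mul]
  rfl

lemma continuous_prim3 (hi : Integrable h) : Continuous (prim3 a h) := by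
  have hm : ∀ k, Continuous (moment a h k) := fun k =>
    intervalIntegral.continuous_primitive (fun c d => intervalIntegrable_pow_mul hi k c d) _
  rw [funext (prim3_eq_moment hi)]
  have h0 := hm 0
  have h1 := hm 1
  have h2 := hm 2
  fun_prop

lemma prim3_congr {g : ℝ → ℂ} (hgh : g =ᵐ[volume] h) : prim3 a g = prim3 a h := by
  funext x
  rw [prim3, prim3]
  congr 1
  refine intervalIntegral.integral_congr_ae ?_
  filter_upwards [hgh] with y hy _
  rw [hy]

lemma prim3_of_le (ha : ∀ y, a ≤ |y| → h y = 0) {x : ℝ} (hx : x ≤ -a) : prim3 a h x = 0 := by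
  rw [prim3, intervalIntegral.integral_zero_ae, mul_zero]
  refine Eventually.of_forall fun y hy => ?_
  rw [Set.uIoc_of_ge hx] at hy
  rw [ha y (le_abs.mpr (Or.inr (by linarith [hy.2]))), mul_zero]

lemma moment_of_ge (ha : ∀ y, a ≤ |y| → h y = 0) (k : ℕ) {x : ℝ} (hx : a ≤ x) (hx' : -a ≤ x) :
    moment a h k x = ∫ y : ℝ, (y : ℂ) ^ k * h y := by
  rw [moment, intervalIntegral.integral_of_le hx', ← integral_indicator measurableSet_Ioc]
  refine integral_congr_ae (Eventually.of_forall fun y => ?_)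
  by_cases hy : y ∈ Set.Ioc (-a) x
  · rw [Set.indicator_of_mem hy]
  · rw [Set.indicator_of_notMem hy]
    simp only
    have : a ≤ |y| := by
      by_contra hlt
      push Not at hlt
      obtain ⟨h1, h2⟩ := abs_lt.mp hlt
      exact hy ⟨h1, (h2.trans_le hx).le⟩
    rw [ha y this, mul_zero]

lemma prim3_of_ge (hi : Integrable h) (ha : ∀ y, a ≤ |y| → h y = 0) {x : ℝ} (hx : a ≤ x)
    (hx' : -a ≤ x) : prim3 a h x = (Complex.I / 2) * ((x : ℂ) ^ 2 * (∫ y, h y)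
      - 2 * x * (∫ y : ℝ, (y : ℂ) ^ 1 * h y) + ∫ y : ℝ, (y : ℂ) ^ 2 * h y) := by
  rw [prim3_eq_moment hi, moment_of_ge ha 0 hx hx', moment_of_ge ha 1 hx hx',
    moment_of_ge ha 2 hx hx']
  simp

/-- The positive part cuts the integral off at x and the support of h cuts it off at -a. -/
lemma integral_fundSol_mul (ha : ∀ y, a ≤ |y| → h y = 0) (x : ℝ) :
    ∫ y, fundSol (x - y) * h y = -prim3 a h x := by
  rcases le_total x (-a) with hx | hx
  · rw [prim3_of_le ha hx, neg_zero]
    refine integral_eq_zero_of_ae (Eventually.of_forall fun y => ?_)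
    rcases le_total x y with hy | hy
    · simp [fundSol, max_eq_right (sub_nonpos.mpr hy)]
    · simp [ha y (le_abs.mpr (Or.inr (by linarith)))]
  · rw [prim3, intervalIntegral.integral_of_le hx, ← integral_indicator measurableSet_Ioc,
      ← integral_const_mul, ← integral_neg]
    refine integral_congr_ae (Eventually.of_forall fun y => ?_)
    simp only
    by_cases hy : y ∈ Set.Ioc (-a) x
    · rw [Set.indicator_of_mem hy, fundSol, max_eq_left (sub_nonneg.mpr hy.2)]
      ring
    · rw [Set.indicator_of_notMem hy, mul_zero, neg_zero]
      rcases le_total x y with hy' | hy'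
      · simp [fundSol, max_eq_right (sub_nonpos.mpr hy')]
      · have : y ≤ -a := by
          by_contra hlt
          exact hy ⟨not_le.mp hlt, hy'⟩
        simp [ha y (le_abs.mpr (Or.inr (by linarith)))]

lemma hasDerivAt_moment (hc : Continuous h) (k : ℕ) (x : ℝ) :
    HasDerivAt (moment a h k) ((x : ℂ) ^ k * h x) x := by
  have hg : Continuous fun y : ℝ => (y : ℂ) ^ k * h y := by fun_prop
  exact intervalIntegral.integral_hasDerivAt_right (hg.intervalIntegrable _ _)
    (hg.stronglyMeasurableAtFilter _ _) hg.continuousAt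

lemma hasDerivAt_prim3 (hi : Integrable h) (hc : Continuous h) :
    ∃ f₁ f₂ : ℝ → ℂ, (∀ x, HasDerivAt (prim3 a h) (f₁ x) x) ∧ (∀ x, HasDerivAt f₁ (f₂ x) x) ∧
      ∀ x, HasDerivAt f₂ (Complex.I * h x) x := by
  have hid : ∀ x : ℝ, HasDerivAt (fun x : ℝ => (x : ℂ)) 1 x := fun x =>
    HasDerivAt.ofReal_comp (hasDerivAt_id x)
  refine ⟨fun x => Complex.I * (x * moment a h 0 x - moment a h 1 x),
    fun x => Complex.I * moment a h 0 x, fun x => ?_, fun x => ?_, fun x => ?_⟩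
  · rw [funext (prim3_eq_moment hi)]
    have := (((((hid x).pow 2).mul (hasDerivAt_moment (a := a) hc 0 x)).sub
      (((hid x).const_mul 2).mul (hasDerivAt_moment (a := a) hc 1 x))).add
        (hasDerivAt_moment (a := a) hc 2 x)).const_mul (Complex.I / 2)
    convert! this using 1
    simp
    ring
  · have := (((hid x).mul (hasDerivAt_moment (a := a) hc 0 x)).sub
      (hasDerivAt_moment (a := a) hc 1 x)).const_mul Complex.I
    convert! this using 1
    ring
  · simpa using (hasDerivAt_moment (a := a) hc 0 x).const_mul Complex.I

/-- Since (-i)³ = i, the equation reads Ψ''' = iVΨ; continuity of V upgrades the chain of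
derivatives to C³. -/
lemma isSolution_iff {V Ψ : ℝ → ℂ} (hV : Continuous V) : IsSolution V Ψ ↔
    ∃ f₁ f₂ : ℝ → ℂ, (∀ x, HasDerivAt Ψ (f₁ x) x) ∧ (∀ x, HasDerivAt f₁ (f₂ x) x) ∧
      ∀ x, HasDerivAt f₂ (Complex.I * (V x * Ψ x)) x := by
  have hI : (-Complex.I) ^ 3 = Complex.I := by
    linear_combination (-Complex.I) * Complex.I_sq
  have hs : (3 : WithTop ℕ∞) = ((2 : ℕ) : WithTop ℕ∞) + 1 := by norm_num
  have hs' : ((2 : ℕ) : WithTop ℕ∞) = ((1 : ℕ) : WithTop ℕ∞) + 1 := by norm_num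
  have hs'' : ((1 : ℕ) : WithTop ℕ∞) = ((0 : ℕ) : WithTop ℕ∞) + 1 := by norm_num
  constructor
  · rintro ⟨hΨ, heq⟩
    rw [hs, contDiff_succ_iff_deriv] at hΨ
    obtain ⟨d0, -, hΨ⟩ := hΨ
    rw [hs', contDiff_succ_iff_deriv] at hΨ
    obtain ⟨d1, -, hΨ⟩ := hΨ
    rw [hs'', contDiff_succ_iff_deriv] at hΨ
    obtain ⟨d2, -, -⟩ := hΨ
    refine ⟨_, _, fun x => (d0 x).hasDerivAt, fun x => (d1 x).hasDerivAt, fun x => ?_⟩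
    have e := heq x
    rw [hI, iteratedDeriv_succ, iteratedDeriv_succ, iteratedDeriv_one] at e
    have e2 : deriv (deriv (deriv Ψ)) x = Complex.I * (V x * Ψ x) := by
      linear_combination (-Complex.I) * e + (deriv (deriv (deriv Ψ)) x) * Complex.I_sq
    rw [← e2]
    exact (d2 x).hasDerivAt
  · rintro ⟨f₁, f₂, h0, h1, h2⟩
    have e0 : deriv Ψ = f₁ := funext fun x => (h0 x).deriv
    have e1 : deriv f₁ = f₂ := funext fun x => (h1 x).deriv
    have e2 : deriv f₂ = fun x => Complex.I * (V x * Ψ x) := funext fun x => (h2 x).deriv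
    have d0 : Differentiable ℝ Ψ := fun x => (h0 x).differentiableAt
    have d1 : Differentiable ℝ f₁ := fun x => (h1 x).differentiableAt
    have d2 : Differentiable ℝ f₂ := fun x => (h2 x).differentiableAt
    refine ⟨?_, fun x => ?_⟩
    · have hc := d0.continuous
      rw [hs, contDiff_succ_iff_deriv, e0]
      refine ⟨d0, by simp, ?_⟩
      rw [hs', contDiff_succ_iff_deriv, e1]
      refine ⟨d1, by simp, ?_⟩
      rw [hs'', contDiff_succ_iff_deriv, e2]
      refine ⟨d2, by simp, ?_⟩
      rw [Nat.cast_zero, contDiff_zero]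
      fun_prop
    · rw [hI, iteratedDeriv_succ, iteratedDeriv_succ, iteratedDeriv_one, e0, e1, e2]
      linear_combination (V x * Ψ x) * Complex.I_sq

lemma eq_const_of_hasDerivAt_zero {f : ℝ → ℂ} (hf : ∀ x, HasDerivAt f 0 x) (x : ℝ) :
    f x = f 0 :=
  is_const_of_deriv_eq_zero (fun x => (hf x).differentiableAt) (fun x => (hf x).deriv) x 0

lemma exists_quadratic {f f₁ f₂ : ℝ → ℂ} (h0 : ∀ x, HasDerivAt f (f₁ x) x)
    (h1 : ∀ x, HasDerivAt f₁ (f₂ x) x) (h2 : ∀ x, HasDerivAt f₂ 0 x) :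
    ∃ α β γ : ℂ, ∀ x : ℝ, f x = α + β * x + γ * x ^ 2 := by
  have hid : ∀ x : ℝ, HasDerivAt (fun x : ℝ => (x : ℂ)) 1 x := fun x =>
    HasDerivAt.ofReal_comp (hasDerivAt_id x)
  have e2 := eq_const_of_hasDerivAt_zero h2
  have e1 : ∀ x : ℝ, f₁ x - f₂ 0 * x = f₁ 0 - f₂ 0 * (0 : ℝ) := by
    refine eq_const_of_hasDerivAt_zero (f := fun x : ℝ => f₁ x - f₂ 0 * x) fun x => ?_
    convert! (h1 x).sub ((hid x).const_mul (f₂ 0)) using 1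
    rw [e2]; ring
  have e0 : ∀ x : ℝ, f x - f₁ 0 * x - f₂ 0 / 2 * (x : ℂ) ^ 2 =
      f 0 - f₁ 0 * (0 : ℝ) - f₂ 0 / 2 * ((0 : ℝ) : ℂ) ^ 2 := by
    refine eq_const_of_hasDerivAt_zero
      (f := fun x : ℝ => f x - f₁ 0 * x - f₂ 0 / 2 * (x : ℂ) ^ 2) fun x => ?_
    convert! ((h0 x).sub ((hid x).const_mul (f₁ 0))).sub
      (((hid x).pow 2).const_mul (f₂ 0 / 2)) using 1
    have := e1 x
    push_cast at this ⊢
    linear_combination -this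
  refine ⟨f 0, f₁ 0, f₂ 0 / 2, fun x => ?_⟩
  have := e0 x
  push_cast at this
  linear_combination this

lemma eq_zero_of_norm_mul_le {γ : ℂ} {K b : ℝ} (hK : ∀ x, b ≤ x → ‖γ‖ * x ≤ K) : γ = 0 := by
  by_contra hγ
  have h0 : 0 < ‖γ‖ := norm_pos_iff.mpr hγ
  have h1 := hK (max b ((K + 1) / ‖γ‖)) (le_max_left _ _)
  have h2 : (K + 1) / ‖γ‖ ≤ max b ((K + 1) / ‖γ‖) := le_max_right _ _
  rw [div_le_iff₀ h0] at h2
  linarith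

lemma linear_bounded {α β : ℂ} {C b : ℝ} (hb : ∀ x : ℝ, b ≤ x → ‖α + β * x‖ ≤ C) : β = 0 := by
  refine eq_zero_of_norm_mul_le (K := C + ‖α‖) (b := max b 0) fun x hx => ?_
  have hx0 : 0 ≤ x := (le_max_right _ _).trans hx
  calc ‖β‖ * x = ‖(α + β * x) - α‖ := by
        rw [add_sub_cancel_left, norm_mul, Complex.norm_real, Real.norm_of_nonneg hx0]
    _ ≤ _ := (norm_sub_le _ _).trans (by linarith [hb x ((le_max_left _ _).trans hx)])

lemma quadratic_linearly_bounded {α β γ : ℂ} {C b : ℝ}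
    (hb : ∀ x : ℝ, b ≤ x → ‖α + β * x + γ * x ^ 2‖ ≤ C * (1 + x)) : γ = 0 := by
  refine eq_zero_of_norm_mul_le (K := 2 * |C| + ‖α‖ + ‖β‖) (b := max b 1) fun x hx => ?_
  have hx1 : 1 ≤ x := (le_max_right _ _).trans hx
  have h1 : ‖γ‖ * x * x ≤ (2 * |C| + ‖α‖ + ‖β‖) * x := by
    calc ‖γ‖ * x * x = ‖(α + β * x + γ * x ^ 2) - α - β * x‖ := by
          have : (α + β * x + γ * x ^ 2) - α - β * x = γ * (x : ℂ) ^ 2 := by ring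
          rw [this, norm_mul, norm_pow, Complex.norm_real, Real.norm_of_nonneg (by linarith)]
          ring
      _ ≤ C * (1 + x) + ‖α‖ + ‖β‖ * x := by
          refine (norm_sub_le _ _).trans (add_le_add ((norm_sub_le _ _).trans ?_) ?_)
          · linarith [hb x ((le_max_left _ _).trans hx)]
          · rw [norm_mul, Complex.norm_real, Real.norm_of_nonneg (by linarith)]
      _ ≤ _ := by
          nlinarith [le_abs_self C, abs_nonneg C, norm_nonneg α, norm_nonneg β]
  exact le_of_mul_le_mul_right h1 (by linarith)

lemma bracket_le (x : ℝ) : bracket x ≤ 1 + |x| := by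
  rw [bracket]
  refine Real.sqrt_le_iff.mpr ⟨by positivity, ?_⟩
  nlinarith [abs_nonneg x, sq_abs x]

/-- A solution with the growth of the second alternative solves an integral equation. -/
lemma eq_const_add_prim3 {V Ψ : ℝ → ℂ} (hV : Continuous V) (hc : HasCompactSupport V)
    (ha : ∀ y, a ≤ |y| → V y = 0) (hΨ : IsSolution V Ψ)
    (hb : ∃ C : ℝ, ∀ x : ℝ, (bracket x)⁻¹ * ‖Ψ x‖ ≤ C)
    (hb' : ∃ C : ℝ, ∀ x : ℝ, x ≤ 0 → ‖Ψ x‖ ≤ C) :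
    (∃ c, ∀ x, Ψ x = c + prim3 a (fun y => V y * Ψ y) x) ∧ ∫ y, V y * Ψ y = 0 := by
  have hΨc : Continuous Ψ := hΨ.1.continuous
  have hh : Continuous fun y => V y * Ψ y := hV.mul hΨc
  have hi : Integrable fun y => V y * Ψ y := hh.integrable_of_hasCompactSupport hc.mul_right
  have ha' : ∀ y, a ≤ |y| → V y * Ψ y = 0 := fun y hy => by rw [ha y hy, zero_mul]
  obtain ⟨f₁, f₂, h0, h1, h2⟩ := (isSolution_iff hV).mp hΨ
  obtain ⟨g₁, g₂, k0, k1, k2⟩ := hasDerivAt_prim3 (a := a) hi hh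
  obtain ⟨α, β, γ, hq⟩ := exists_quadratic (fun x => (h0 x).sub (k0 x))
    (fun x => (h1 x).sub (k1 x)) (fun x => by have := (h2 x).sub (k2 x); rwa [sub_self] at this)
  simp only [Pi.sub_apply] at hq
  obtain ⟨C, hC⟩ := hb
  obtain ⟨C', hC'⟩ := hb'
  -- To the left of the support the primitive vanishes, so Ψ is the polynomial itself. Reflecting x
  -- to -x brings this to a positive half-line and flips the sign of β.
  have hleft : ∀ x : ℝ, max a 0 ≤ x → ‖α + (-β) * x + γ * x ^ 2‖ ≤ C' := fun x hx => by
    have e := hq (-x)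
    rw [prim3_of_le ha' (by linarith [(le_max_left a 0).trans hx]), sub_zero] at e
    have e2 : α + (-β) * x + γ * x ^ 2 = Ψ (-x) := by rw [e]; push_cast; ring
    rw [e2]
    exact hC' _ (by linarith [(le_max_right a 0).trans hx])
  have hC0 : 0 ≤ C' := (norm_nonneg _).trans (hC' 0 le_rfl)
  have hγ : γ = 0 := quadratic_linearly_bounded (C := C') (b := max a 0) fun x hx =>
    (hleft x hx).trans (by nlinarith [(le_max_right a 0).trans hx])
  subst hγ
  have hβ : -β = 0 := linear_bounded (C := C') (b := max a 0) fun x hx => by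
    simpa using hleft x hx
  rw [neg_eq_zero] at hβ
  subst hβ
  have hrep : ∀ x, Ψ x = α + prim3 a (fun y => V y * Ψ y) x := fun x => by
    linear_combination hq x
  refine ⟨⟨α, hrep⟩, ?_⟩
  -- To the right of the support Ψ is quadratic with this leading coefficient, which linear growth
  -- forces to vanish.
  have hγ : Complex.I / 2 * (∫ y, V y * Ψ y) = 0 := by
    refine quadratic_linearly_bounded (C := C) (b := |a|)
      (α := α + Complex.I / 2 * ∫ y : ℝ, (y : ℂ) ^ 2 * (V y * Ψ y))
      (β := -Complex.I * ∫ y : ℝ, (y : ℂ) ^ 1 * (V y * Ψ y)) fun x hx => ?_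
    have e : α + Complex.I / 2 * (∫ y : ℝ, (y : ℂ) ^ 2 * (V y * Ψ y)) +
        -Complex.I * (∫ y : ℝ, (y : ℂ) ^ 1 * (V y * Ψ y)) * x +
        Complex.I / 2 * (∫ y, V y * Ψ y) * (x : ℂ) ^ 2 = Ψ x := by
      rw [hrep, prim3_of_ge hi ha' ((le_abs_self a).trans hx) ((neg_le_abs a).trans hx)]
      ring
    rw [e]
    have h3 := hC x
    rw [inv_mul_le_iff₀ (bracket_pos x)] at h3
    have hx0 : 0 ≤ x := (abs_nonneg a).trans hx
    have hC1 : 0 ≤ C := le_trans (by have := bracket_pos 0; positivity) (hC 0)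
    refine h3.trans ?_
    rw [mul_comm]
    have := bracket_le x
    rw [abs_of_nonneg hx0] at this
    gcongr
  have hI : Complex.I / 2 ≠ 0 := by simp
  exact (mul_eq_zero.mp hγ).resolve_left hI

/-- A continuous solution of the integral equation has the growth of the second alternative. -/
lemma isSolution_of_eq_const_add_prim3 {V Ψ : ℝ → ℂ} (hV : Continuous V)
    (hc : HasCompactSupport V) (ha : ∀ y, a ≤ |y| → V y = 0) (hΨc : Continuous Ψ) {c : ℂ}
    (hrep : ∀ x, Ψ x = c + prim3 a (fun y => V y * Ψ y) x) (h0 : ∫ y, V y * Ψ y = 0) :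
    IsSolution V Ψ ∧ (∃ C : ℝ, ∀ x : ℝ, (bracket x)⁻¹ * ‖Ψ x‖ ≤ C) ∧
      ∃ C : ℝ, ∀ x : ℝ, x ≤ 0 → ‖Ψ x‖ ≤ C := by
  have hh : Continuous fun y => V y * Ψ y := hV.mul hΨc
  have hi : Integrable fun y => V y * Ψ y := hh.integrable_of_hasCompactSupport hc.mul_right
  have ha' : ∀ y, a ≤ |y| → V y * Ψ y = 0 := fun y hy => by rw [ha y hy, zero_mul]
  obtain ⟨g₁, g₂, k0, k1, k2⟩ := hasDerivAt_prim3 (a := a) hi hh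
  -- Continuity bounds Ψ on the middle interval; outside it Ψ is constant on the left and affine on
  -- the right. The sign of a is not known, hence |a|.
  obtain ⟨K, hK⟩ := (isCompact_Icc (a := -|a|) (b := |a|)).exists_bound_of_continuousOn
    hΨc.continuousOn
  have hK0 : 0 ≤ K := (norm_nonneg _).trans (hK 0 ⟨by simp, by simp⟩)
  have hleft : ∀ x, x ≤ -|a| → Ψ x = c := fun x hx => by
    rw [hrep, prim3_of_le ha' (hx.trans (neg_le_neg (le_abs_self a))), add_zero]
  refine ⟨(isSolution_iff hV).mpr ⟨g₁, g₂, fun x => ?_, k1, k2⟩, ?_, ⟨K + ‖c‖, fun x hx => ?_⟩⟩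
  · rw [funext hrep]
    exact (k0 x).const_add c
  · set n₁ := ∫ y : ℝ, (y : ℂ) ^ 1 * (V y * Ψ y)
    set n₂ := ∫ y : ℝ, (y : ℂ) ^ 2 * (V y * Ψ y)
    refine ⟨K + ‖c‖ + ‖n₁‖ + ‖n₂‖, fun x => ?_⟩
    rw [inv_mul_le_iff₀ (bracket_pos x)]
    have hb := one_le_bracket x
    have hpos : 0 ≤ K + ‖c‖ + ‖n₁‖ + ‖n₂‖ := by positivity
    rcases le_or_gt x (-|a|) with hx | hx
    · rw [hleft x hx]
      nlinarith [norm_nonneg c, norm_nonneg n₁, norm_nonneg n₂]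
    rcases le_or_gt x |a| with hx' | hx'
    · have := hK x ⟨hx.le, hx'⟩
      nlinarith [norm_nonneg c, norm_nonneg n₁, norm_nonneg n₂]
    · have e : Ψ x = c + (-Complex.I * n₁ * x + Complex.I / 2 * n₂) := by
        rw [hrep, prim3_of_ge hi ha' ((le_abs_self a).trans hx'.le) ((neg_le_abs a).trans hx'.le),
          h0]
        ring
      have h1 : ‖Ψ x‖ ≤ ‖c‖ + (‖n₁‖ * |x| + 1 / 2 * ‖n₂‖) := by
        rw [e]
        refine (norm_add_le _ _).trans (add_le_add_right ((norm_add_le _ _).trans ?_) _)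
        simp
      have := abs_le_bracket x
      refine h1.trans ?_
      have h2 : ‖n₁‖ * |x| ≤ ‖n₁‖ * bracket x := by gcongr
      nlinarith [norm_nonneg c, norm_nonneg n₁, norm_nonneg n₂]
  · rcases le_or_gt x (-|a|) with hx' | hx'
    · rw [hleft x hx']
      linarith
    · linarith [hK x ⟨hx'.le, hx.trans (abs_nonneg a)⟩, norm_nonneg c]

end Solutions

/-! ### The regularised free resolvent near zero energy -/

noncomputable section Limit

instance : (𝓝[{z : ℂ | 0 < z.im}] 0).NeBot := by
  rw [← mem_closure_iff_nhdsWithin_neBot, Complex.closure_setOfPred_lt_im]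
  simp

lemma eventually_im_pos : ∀ᶠ z in 𝓝[{z : ℂ | 0 < z.im}] 0, 0 < z.im := self_mem_nhdsWithin

lemma continuous_fundSol : Continuous fundSol := by unfold fundSol; fun_prop

lemma continuous_limKer : Continuous fun x : ℝ × ℝ => limKer x.1 x.2 := by
  have := continuous_fundSol
  unfold limKer
  fun_prop

lemma continuous_regKer (lam : ℂ) : Continuous fun x : ℝ × ℝ => regKer lam x.1 x.2 := by
  have := continuous_prof lam
  unfold regKer
  fun_prop

lemma norm_limKer_le (x y : ℝ) : ‖limKer x y‖ ≤ 2 * |x| * |y| := by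
  refine le_of_tendsto ((tendsto_regKer x y).comp tendsto_root).norm ?_
  filter_upwards [eventually_im_pos] with z hz
  exact norm_regKer_le (adm_root hz) x y

/-- The regularised kernel of the free resolvent, extended by its limit at zero energy. -/
def ker (z : ℂ) : ℝ → ℝ → ℂ := if 0 < z.im then regKer (root z) else limKer

/-- The profile of the singular part of the free resolvent, extended by its limit. -/
def profExt (z : ℂ) : ℝ → ℂ := if 0 < z.im then prof (root z) else fun _ => 1

lemma abs_mul_abs_le_bracket (x y : ℝ) : 2 * |x| * |y| ≤ 4 * bracket x * bracket y := by
  have := abs_le_bracket x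
  have := abs_le_bracket y
  have := bracket_pos x
  have := bracket_pos y
  have : |x| * |y| ≤ bracket x * bracket y := by gcongr
  nlinarith [mul_pos (bracket_pos x) (bracket_pos y)]

lemma norm_limKer_le_bracket (x y : ℝ) : ‖limKer x y‖ ≤ 4 * bracket x * bracket y :=
  (norm_limKer_le x y).trans (abs_mul_abs_le_bracket x y)

/-- Valid for every z thanks to the extension by the limit, so that an operator is defined at each
index of the filter. -/
lemma norm_ker_le (z : ℂ) (x y : ℝ) : ‖ker z x y‖ ≤ 4 * bracket x * bracket y := by
  unfold ker
  split_ifs with h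
  · exact (norm_regKer_le (adm_root h) x y).trans (abs_mul_abs_le_bracket x y)
  · exact norm_limKer_le_bracket x y

lemma measurable_ker (z : ℂ) : Measurable fun x : ℝ × ℝ => ker z x.1 x.2 := by
  unfold ker
  split_ifs with h
  · exact (continuous_regKer _).measurable
  · exact continuous_limKer.measurable

lemma tendsto_ker (x y : ℝ) :
    Tendsto (fun z => ker z x y) (𝓝[{z : ℂ | 0 < z.im}] 0) (𝓝 (limKer x y)) := by
  refine ((tendsto_regKer x y).comp tendsto_root).congr' ?_
  filter_upwards [eventually_im_pos] with z hz
  simp [ker, hz]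

lemma continuous_profExt (z : ℂ) : Continuous (profExt z) := by
  unfold profExt
  split_ifs with h
  · exact continuous_prof _
  · exact continuous_const

lemma norm_profExt_le (z : ℂ) (x y : ℝ) : ‖profExt z x‖ ≤ 2 * bracket y := by
  have hb := one_le_bracket y
  unfold profExt
  split_ifs with h
  · exact (norm_prof_le (adm_root h) x).trans (by linarith)
  · simp only [norm_one]; linarith

lemma tendsto_profExt (x : ℝ) :
    Tendsto (fun z => profExt z x) (𝓝[{z : ℂ | 0 < z.im}] 0) (𝓝 1) := by
  refine ((tendsto_prof x).comp tendsto_root).congr' ?_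
  filter_upwards [eventually_im_pos] with z hz
  simp [profExt, hz]

lemma norm_one_le (y : ℝ) : ‖(1 : ℂ)‖ ≤ 2 * bracket y := by
  have := one_le_bracket y
  rw [norm_one]; linarith

/-- The free resolvent, extended by zero to the closed lower half plane. -/
def freeResExt (z : ℂ) : L2 →L[ℂ] L2 := if h : 0 < z.im then freeRes h else 0

lemma isResolvent_freeResExt :
    ∀ᶠ z in 𝓝[{z : ℂ | 0 < z.im}] 0, IsResolvent A z (freeResExt z) := by
  filter_upwards [eventually_im_pos] with z hz
  rw [freeResExt, dif_pos hz]
  exact isResolvent_freeRes hz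

lemma kap_ne_zero {lam : ℂ} (h : lam ≠ 0) : kap lam ≠ 0 := by simp [kap, h]

lemma eventually_kap_ne_zero : ∀ᶠ z in 𝓝[{z : ℂ | 0 < z.im}] 0, kap (root z) ≠ 0 := by
  filter_upwards [eventually_im_pos] with z hz
  exact kap_ne_zero (adm_root hz).ne_zero

lemma tendsto_kap_inv :
    Tendsto (fun z => (kap (root z))⁻¹) (𝓝[{z : ℂ | 0 < z.im}] 0) (𝓝 0) := by
  have h : Continuous fun lam : ℂ => (kap lam)⁻¹ := by
    have : (fun lam : ℂ => (kap lam)⁻¹) = fun lam => 3 * lam ^ 2 / Complex.I := by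
      funext lam; rw [kap, inv_div]
    rw [this]; fun_prop
  have h0 := h.tendsto 0
  simp only [kap, ne_eq, OfNat.ofNat_ne_zero, not_false_eq_true, zero_pow, mul_zero, div_zero,
    inv_zero] at h0
  exact (h0.mono_left nhdsWithin_le_nhds).comp tendsto_root

variable {s s' : ℝ}

/-- The regular part of the free resolvent. -/
def regOp (hs : 3 / 2 < s) (hs' : 3 / 2 < s') (z : ℂ) : L2w s →L[ℂ] L2w (-s') :=
  kernelOp hs hs' (ker z) (measurable_ker z) (norm_ker_le z)

/-- The limit at zero energy of the regular part of the free resolvent. -/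
def limOp (hs : 3 / 2 < s) (hs' : 3 / 2 < s') : L2w s →L[ℂ] L2w (-s') :=
  kernelOp hs hs' limKer continuous_limKer.measurable norm_limKer_le_bracket

lemma tendsto_regOp (hs : 3 / 2 < s) (hs' : 3 / 2 < s') :
    Tendsto (regOp hs hs') (𝓝[{z : ℂ | 0 < z.im}] 0) (𝓝 (limOp hs hs')) :=
  tendsto_kernelOp hs hs' measurable_ker norm_ker_le _ _ tendsto_ker

lemma memLp_profExt (hs' : 3 / 2 < s') (z : ℂ) : MemLp (profExt z) 2 (weight (-s')) :=
  memLp_weight_neg_of_le hs' (continuous_profExt z).aestronglyMeasurable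
    fun y => norm_profExt_le z y y

lemma memLp_one_weight (hs' : 3 / 2 < s') : MemLp (fun _ => (1 : ℂ)) 2 (weight (-s')) :=
  memLp_weight_neg_of_le hs' aestronglyMeasurable_const norm_one_le

lemma tendsto_profExt_toLp (hs' : 3 / 2 < s') :
    Tendsto (fun z => (memLp_profExt hs' z).toLp (profExt z)) (𝓝[{z : ℂ | 0 < z.im}] 0)
      (𝓝 ((memLp_one_weight hs').toLp _)) :=
  tendsto_toLp_of_dominated (fun z => (continuous_profExt z).measurable) measurable_const _ _
    ((memLp_bracket_rpow (r := 1) (t := -s') (by linarith)).const_mul 2)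
    (Eventually.of_forall fun z y => by simpa using norm_profExt_le z y y)
    (fun y => by simpa using norm_one_le y) tendsto_profExt

/-- The functional in the singular part of the free resolvent. -/
def singFun (hs : 3 / 2 < s) (z : ℂ) : L2w s →L[ℂ] ℂ :=
  pairing (C := 2) hs (fun y => profExt z (-y)) ((continuous_profExt z).comp continuous_neg).measurable
    fun y => norm_profExt_le z (-y) y

/-- Integration, as a functional on `L²_s`. -/
def integralFun (hs : 3 / 2 < s) : L2w s →L[ℂ] ℂ :=
  pairing (C := 2) hs (fun _ => 1) measurable_const norm_one_le

lemma integralFun_apply (hs : 3 / 2 < s) (f : L2w s) : integralFun hs f = ∫ y, f y := by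
  rw [integralFun, pairing_apply]
  simp

lemma tendsto_singFun (hs : 3 / 2 < s) :
    Tendsto (singFun hs) (𝓝[{z : ℂ | 0 < z.im}] 0) (𝓝 (integralFun hs)) :=
  tendsto_pairing hs _ _ _ _ fun y => tendsto_profExt (-y)

lemma coeFn_add_smul_weight {t : ℝ} (f g : L2w t) (c : ℂ) :
    (f + c • g : L2w t) =ᵐ[volume] fun x => f x + c * g x := by
  rw [← ae_weight t]
  filter_upwards [Lp.coeFn_add f (c • g), Lp.coeFn_smul c g] with x h1 h2
  rw [h1, Pi.add_apply, h2, Pi.smul_apply, smul_eq_mul]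

lemma coeFn_zero_weight (t : ℝ) : ((0 : L2w t) : ℝ → ℂ) =ᵐ[volume] 0 := by
  rw [← ae_weight t]
  exact Lp.coeFn_zero ℂ 2 _

lemma ext_weight {t : ℝ} {f g : L2w t} (h : f =ᵐ[volume] g) : f = g :=
  Lp.ext (by rwa [EventuallyEq, ae_weight])

lemma coeFn_toLp_weight {t : ℝ} {f : ℝ → ℂ} (hf : MemLp f 2 (weight t)) :
    hf.toLp f =ᵐ[volume] f := by
  rw [← ae_weight t]
  exact hf.coeFn_toLp

/-- The splitting into regular part plus diverging rank-one part, in the shape the abstract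
perturbation theorems require. -/
lemma embOut_freeResExt_embIn (hs : 3 / 2 < s) (hs' : 3 / 2 < s') (h0 : 0 ≤ s) (h0' : 0 ≤ s') :
    ∀ᶠ z in 𝓝[{z : ℂ | 0 < z.im}] 0, ∀ f : L2w s, embOut h0' (freeResExt z (embIn h0 f)) =
      regOp hs hs' z f + (kap (root z) * singFun hs z f) •
        (memLp_profExt hs' z).toLp (profExt z) := by
  filter_upwards [eventually_im_pos] with z hz f
  have hfi : Integrable f := integrable_of_memLp_weight hs (Lp.memLp f)
  have hint : Integrable (embIn h0 f) := hfi.congr (embIn_coeFn h0 f).symm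
  have hR := freeRes_ae_eq (adm_root hz) (root_cube z) hz (embIn h0 f) hint
  refine ext_weight ?_
  filter_upwards [embOut_coeFn h0' (freeResExt z (embIn h0 f)), hR,
    coeFn_add_smul_weight (regOp hs hs' z f) ((memLp_profExt hs' z).toLp (profExt z))
      (kap (root z) * singFun hs z f),
    kernelOp_coeFn hs hs' (ker z) (measurable_ker z) (norm_ker_le z) f,
    coeFn_toLp_weight (memLp_profExt hs' z)] with x h1 h2 h3 h4 h5
  rw [h1, freeResExt, dif_pos hz, h2, h3, regOp, h4, h5, singFun, pairing_apply, mul_assoc,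
    mul_comm (∫ y, _) (profExt z x), ← integral_const_mul, ← integral_const_mul, ← integral_add]
  · refine integral_congr_ae ?_
    filter_upwards [embIn_coeFn h0 f] with y hy
    rw [hy]
    simp only [ker, profExt, hz, if_true, regKer]
    ring
  · refine integrable_mul_of_memLp_weight (C := 4 * bracket x) hs
      ((measurable_ker z).comp measurable_prodMk_left) (norm_ker_le z x) (Lp.memLp f)
  · refine Integrable.const_mul (Integrable.const_mul ?_ _) _
    exact integrable_mul_of_memLp_weight (C := 2) hs
      ((continuous_profExt z).comp continuous_neg).measurable
      (fun y => norm_profExt_le z (-y) y) (Lp.memLp f)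

end Limit

/-! ### Compactness of the limiting operator -/

section Compactness

lemma isCompactOperator_hsOp_sum {α β ι : Type*} [MeasurableSpace α] [MeasurableSpace β]
    {μ : Measure α} {ν : Measure β} [SFinite μ] [SFinite ν] {a : ι → β → ℂ} {b : ι → α → ℂ}
    (ha : ∀ j, MemLp (a j) 2 ν) (hb : ∀ j, MemLp (b j) 2 μ) (S : Finset ι)
    (h : MemLp (fun x : β × α => ∑ j ∈ S, a j x.1 * b j x.2) 2 (ν.prod μ)) :
    IsCompactOperator (hsOp _ h) := by
  classical
  have hm : ∀ j, MemLp (fun x : β × α => a j x.1 * b j x.2) 2 (ν.prod μ) := fun j =>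
    (MemLp.mul_prod (ha j).norm (hb j).norm).mono' ((ha j).1.comp_fst.mul (hb j).1.comp_snd)
      (Eventually.of_forall fun x => (norm_mul _ _).le)
  induction S using Finset.induction_on with
  | empty =>
    have e : hsOp _ h = 0 := by
      have := norm_hsOp_le _ h
      simp only [Finset.sum_empty, eLpNorm_zero', ENNReal.toReal_zero, norm_le_zero_iff] at this
      exact this
    rw [e]
    exact isCompactOperator_zero
  | insert j S hj ih =>
    have hS : MemLp (fun x : β × α => ∑ j ∈ S, a j x.1 * b j x.2) 2 (ν.prod μ) :=
      memLp_finsetSum S fun j _ => hm j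
    have e : hsOp _ h = hsOp _ (hm j) + hsOp _ hS := by
      rw [← hsOp_add]
      congr 1
      funext x
      simp [Finset.sum_insert hj]
    rw [e]
    exact (isCompactOperator_hsOp_mul (hb j) (ha j) (hm j)).add (ih hS)

/-- The approximation of `limKer` by kernels of finite rank, piecewise constant in the second
variable. -/
noncomputable def stepKer (n : ℕ) (x y : ℝ) : ℂ :=
  ∑ j ∈ Finset.Ico (-((n : ℤ) + 1) ^ 2) (((n : ℤ) + 1) ^ 2),
    limKer x ((j : ℤ) / (n + 1)) * (if ⌊((n : ℝ) + 1) * y⌋ = j then 1 else 0)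

lemma stepKer_eq (n : ℕ) (x y : ℝ) : stepKer n x y =
    if ⌊((n : ℝ) + 1) * y⌋ ∈ Finset.Ico (-((n : ℤ) + 1) ^ 2) (((n : ℤ) + 1) ^ 2) then
      limKer x (⌊((n : ℝ) + 1) * y⌋ / (n + 1)) else 0 := by
  simp only [stepKer, mul_ite, mul_one, mul_zero]
  rw [Finset.sum_ite_eq]

lemma abs_floor_div_sub_le (n : ℕ) (y : ℝ) :
    |(⌊((n : ℝ) + 1) * y⌋ : ℝ) / (n + 1) - y| ≤ 1 / ((n : ℝ) + 1) := by
  have hn : (0 : ℝ) < (n : ℝ) + 1 := by positivity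
  have h1 := Int.floor_le (((n : ℝ) + 1) * y)
  have h2 := Int.lt_floor_add_one (((n : ℝ) + 1) * y)
  have e : (⌊((n : ℝ) + 1) * y⌋ : ℝ) / (n + 1) - y =
      ((⌊((n : ℝ) + 1) * y⌋ : ℝ) - (n + 1) * y) / (n + 1) := by field_simp
  rw [e, abs_div, abs_of_pos hn]
  gcongr
  rw [abs_le]
  constructor <;> linarith

/-- The grid point is within 1 of y, hence at most 2⟨y⟩ in modulus; the majorant is therefore the
one used for `limKer`. -/
lemma norm_stepKer_le (n : ℕ) (x y : ℝ) : ‖stepKer n x y‖ ≤ 4 * bracket x * bracket y := by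
  have hx := bracket_pos x
  have hy := one_le_bracket y
  rw [stepKer_eq]
  split_ifs
  · refine (norm_limKer_le _ _).trans ?_
    have h1 := abs_floor_div_sub_le n y
    have h2 : 1 / ((n : ℝ) + 1) ≤ 1 := by
      rw [div_le_one (by positivity)]; linarith [(Nat.cast_nonneg n : (0 : ℝ) ≤ n)]
    have h3 : |(⌊((n : ℝ) + 1) * y⌋ : ℝ) / (n + 1)| ≤ 2 * bracket y := by
      have h4 := abs_le_bracket y
      have h5 := abs_add_le ((⌊((n : ℝ) + 1) * y⌋ : ℝ) / (n + 1) - y) y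
      rw [sub_add_cancel] at h5
      linarith
    calc 2 * |x| * |(⌊((n : ℝ) + 1) * y⌋ : ℝ) / (n + 1)| ≤ 2 * bracket x * (2 * bracket y) := by
          gcongr
          exact abs_le_bracket x
      _ = 4 * bracket x * bracket y := by ring
  · rw [norm_zero]; positivity

lemma measurable_indicator_floor (n : ℕ) (j : ℤ) :
    Measurable fun y : ℝ => if ⌊((n : ℝ) + 1) * y⌋ = j then (1 : ℂ) else 0 :=
  Measurable.ite ((Int.measurable_floor.comp (measurable_const.mul measurable_id))
    (measurableSet_singleton j)) measurable_const measurable_const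

lemma measurable_stepKer (n : ℕ) : Measurable fun x : ℝ × ℝ => stepKer n x.1 x.2 := by
  refine Finset.measurable_sum _ fun j _ => Measurable.mul ?_ ?_
  · exact (continuous_limKer.comp (continuous_fst.prodMk continuous_const)).measurable
  · exact (measurable_indicator_floor n j).comp measurable_snd

/-- The mesh 1/(n+1) shrinks while the grid covers [-(n+1), n+1), so y is eventually inside and
continuity of `limKer` applies. -/
lemma tendsto_stepKer (x y : ℝ) : Tendsto (fun n => stepKer n x y) atTop (𝓝 (limKer x y)) := by
  have h1 : Tendsto (fun n : ℕ => (⌊((n : ℝ) + 1) * y⌋ : ℝ) / (n + 1)) atTop (𝓝 y) := by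
    rw [tendsto_iff_dist_tendsto_zero]
    exact squeeze_zero (fun _ => dist_nonneg) (fun n => abs_floor_div_sub_le n y)
      tendsto_one_div_add_atTop_nhds_zero_nat
  have h2 : Tendsto (fun n : ℕ => limKer x ((⌊((n : ℝ) + 1) * y⌋ : ℝ) / (n + 1))) atTop
      (𝓝 (limKer x y)) :=
    ((continuous_limKer.comp (continuous_const.prodMk continuous_id)).tendsto y).comp h1
  refine h2.congr' ?_
  filter_upwards [eventually_ge_atTop ⌈|y|⌉₊] with n hn
  have hny : |y| ≤ n := (Nat.le_ceil _).trans (by exact_mod_cast hn)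
  obtain ⟨h3, h4⟩ := abs_le.mp hny
  rw [stepKer_eq, if_pos]
  rw [Finset.mem_Ico, Int.le_floor, Int.floor_lt]
  push_cast
  have hn0 : (0 : ℝ) ≤ n := Nat.cast_nonneg n
  constructor <;> nlinarith

variable {s s' : ℝ}

lemma isCompactOperator_stepKer (hs : 3 / 2 < s) (hs' : 3 / 2 < s') (n : ℕ) :
    IsCompactOperator
      (kernelOp hs hs' (stepKer n) (measurable_stepKer n) (norm_stepKer_le n)) := by
  have ha : ∀ j : ℤ, MemLp (fun x => limKer x (j / (n + 1))) 2 (weight (-s')) := fun j => by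
    refine memLp_weight_neg_of_le (C := 4 * bracket (j / (n + 1))) hs'
      (continuous_limKer.comp
        (continuous_id.prodMk continuous_const)).aestronglyMeasurable fun x => ?_
    exact (norm_limKer_le_bracket x _).trans (by linarith)
  have hb : ∀ j : ℤ, MemLp (dens s fun y : ℝ => if ⌊((n : ℝ) + 1) * y⌋ = j then (1 : ℂ) else 0) 2
      (weight s) := fun j =>
    memLp_dens (C := 1) hs (measurable_indicator_floor n j) fun y => by
      have := one_le_bracket y
      split_ifs
      · simpa using this
      · rw [norm_zero]; linarith
  have e : (fun x : ℝ × ℝ => dens s (stepKer n x.1) x.2) = fun x : ℝ × ℝ =>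
      ∑ j ∈ Finset.Ico (-((n : ℤ) + 1) ^ 2) (((n : ℤ) + 1) ^ 2), limKer x.1 ((j : ℤ) / (n + 1)) *
        dens s (fun y : ℝ => if ⌊((n : ℝ) + 1) * y⌋ = j then (1 : ℂ) else 0) x.2 := by
    funext x
    simp only [dens, stepKer, Finset.sum_mul, mul_assoc]
  have h := memLp_dens_kernel hs hs' (measurable_stepKer n) (norm_stepKer_le n)
  -- `hsOp` carries a proof about its kernel, so the equality of kernels is substituted for a
  -- variable K.
  have key : ∀ (K : ℝ × ℝ → ℂ) (_ : K = fun x : ℝ × ℝ =>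
      ∑ j ∈ Finset.Ico (-((n : ℤ) + 1) ^ 2) (((n : ℤ) + 1) ^ 2), limKer x.1 ((j : ℤ) / (n + 1)) *
        dens s (fun y : ℝ => if ⌊((n : ℝ) + 1) * y⌋ = j then (1 : ℂ) else 0) x.2)
      (hK : MemLp K 2 ((weight (-s')).prod (weight s))), IsCompactOperator (hsOp K hK) := by
    rintro K rfl hK
    exact isCompactOperator_hsOp_sum ha hb _ hK
  exact key _ e h

lemma isCompactOperator_limOp (hs : 3 / 2 < s) (hs' : 3 / 2 < s') :
    IsCompactOperator (limOp hs hs') :=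
  isCompactOperator_of_tendsto
    (tendsto_kernelOp hs hs' measurable_stepKer norm_stepKer_le continuous_limKer.measurable
      norm_limKer_le_bracket tendsto_stepKer)
    (Eventually.of_forall fun n => isCompactOperator_stepKer hs hs' n)

end Compactness

/-! ### The null space of the limiting operator -/

section NullSpace

variable {s s' : ℝ} {V : ℝ → ℂ}

lemma exists_support_bound (hc : HasCompactSupport V) : ∃ a : ℝ, ∀ y, a ≤ |y| → V y = 0 := by
  obtain ⟨R, -, hR⟩ := hc.exists_pos_le_norm
  exact ⟨R, fun y hy => hR y hy⟩

lemma integrable_limit_mul (hV : Continuous V) (hc : HasCompactSupport V) {g : ℝ → ℂ}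
    (hg : Continuous g) {t : ℝ} (u : L2w t) : Integrable fun y => g y * (V y * u y) := by
  have h := integrable_of_memLp_weight (s := 2) (by norm_num)
    (memLp_mul_potential (s := 2) (hg.mul hV) hc.mul_left u)
  simpa only [Pi.mul_apply, mul_assoc] using h

/-- The vanishing integral kills the `fundSol x` term, the only other x-dependent one; a convolution
and a constant remain. -/
lemma integral_limKer_mul (hV : Continuous V) (hc : HasCompactSupport V) {a : ℝ}
    (ha : ∀ y, a ≤ |y| → V y = 0) {t : ℝ} (u : L2w t) (h0 : ∫ y, V y * u y = 0) (x : ℝ) :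
    ∫ y, limKer x y * (V y * u y) =
      -prim3 a (fun y => V y * u y) x - ∫ y, fundSol (-y) * (V y * u y) := by
  have hf := continuous_fundSol
  have h1 := integrable_limit_mul hV hc (g := fun y => fundSol (x - y)) (by fun_prop) u
  have h2 := integrable_limit_mul hV hc (g := fun _ => fundSol x) (by fun_prop) u
  have h3 := integrable_limit_mul hV hc (g := fun y => fundSol (-y)) (by fun_prop) u
  have h12 : Integrable fun y => fundSol (x - y) * (V y * u y) - fundSol x * (V y * u y) :=
    h1.sub h2
  simp only [limKer, sub_mul]
  rw [integral_sub h12 h3, integral_sub h1 h2, integral_const_mul, h0, mul_zero, sub_zero,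
    integral_fundSol_mul fun y hy => by rw [ha y hy, zero_mul]]

/-- The pair `(u, c)` is in the null space of the limiting block operator if and only if `u` solves
the integral equation equivalent to the differential equation. -/
lemma blockOp_eq_zero_iff (hs : 3 / 2 < s) (hs' : 3 / 2 < s') (hV : Continuous V)
    (hc : HasCompactSupport V) {a : ℝ} (ha : ∀ y, a ≤ |y| → V y = 0) (u : L2w (-s')) (c : ℂ) :
    blockOp (limOp hs hs') (mulWeight V hV hc (-s') s) ((memLp_one_weight hs').toLp _)
      (integralFun hs) 0 (u, c) = 0 ↔
    ∫ y, V y * u y = 0 ∧ u =ᵐ[volume] fun x =>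
      c + (∫ y, fundSol (-y) * (V y * u y)) + prim3 a (fun y => V y * u y) x := by
  have hVu := mulWeight_coeFn V hV hc (-s') s u
  rw [blockOp_apply, Prod.mk_eq_zero, zero_mul, add_zero, integralFun_apply,
    integral_congr_ae hVu, and_comm]
  refine and_congr_right fun h0 => ?_
  have hG : limOp hs hs' (mulWeight V hV hc (-s') s u) =ᵐ[volume] fun x =>
      -prim3 a (fun y => V y * u y) x - ∫ y, fundSol (-y) * (V y * u y) := by
    refine (kernelOp_coeFn hs hs' _ _ _ _).trans (Eventually.of_forall fun x => ?_)
    simp only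
    rw [← integral_limKer_mul hV hc ha u h0 x]
    refine integral_congr_ae ?_
    filter_upwards [hVu] with y hy
    rw [hy]
  have h1 := coeFn_toLp_weight (memLp_one_weight hs')
  have e : u + limOp hs hs' (mulWeight V hV hc (-s') s u) - c • (memLp_one_weight hs').toLp _ = 0 ↔
      u = (-1 : ℂ) • (limOp hs hs' (mulWeight V hV hc (-s') s u)
        + (-c) • (memLp_one_weight hs').toLp _) := by
    constructor <;> intro h <;> linear_combination (norm := module) h
  rw [e]
  have h2 := coeFn_add_smul_weight (limOp hs hs' (mulWeight V hV hc (-s') s u))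
    ((memLp_one_weight hs').toLp _) (-c)
  have h3 := coeFn_add_smul_weight 0 (limOp hs hs' (mulWeight V hV hc (-s') s u)
        + (-c) • (memLp_one_weight hs').toLp _) (-1)
  rw [zero_add] at h3
  have hz := coeFn_zero_weight (-s')
  have h4 : (((-1 : ℂ) • (limOp hs hs' (mulWeight V hV hc (-s') s u)
      + (-c) • (memLp_one_weight hs').toLp _) : L2w (-s')) : ℝ → ℂ) =ᵐ[volume] fun x =>
      c + (∫ y, fundSol (-y) * (V y * u y)) + prim3 a (fun y => V y * u y) x := by
    filter_upwards [h1, h2, h3, hG, hz] with x h1 h2 h3 hG hz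
    rw [h3, hz, h2, hG, h1, Pi.zero_apply]
    ring
  exact ⟨fun h => (EventuallyEq.of_eq (congrArg (fun w : L2w (-s') => (w : ℝ → ℂ)) h)).trans h4,
    fun h => ext_weight (h.trans h4.symm)⟩

/-- The second alternative: there is a nonzero solution of linear growth, bounded on the left. -/
def HasBoundedSolution (V : ℝ → ℂ) : Prop :=
  ∃ Ψ : ℝ → ℂ, Ψ ≠ 0 ∧ IsSolution V Ψ ∧ (∃ C : ℝ, ∀ x : ℝ, (bracket x)⁻¹ * ‖Ψ x‖ ≤ C) ∧
    ∃ C : ℝ, ∀ x : ℝ, x ≤ 0 → ‖Ψ x‖ ≤ C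

/-- A null vector u has a continuous representative Ψ solving the integral equation, so Ψ = 0 by
assumption. The first component then reads -c·1 = 0. -/
lemma eq_zero_of_blockOp_eq_zero (hs : 3 / 2 < s) (hs' : 3 / 2 < s') (hV : Continuous V)
    (hc : HasCompactSupport V) (hno : ¬HasBoundedSolution V) (u : L2w (-s')) (c : ℂ)
    (h : blockOp (limOp hs hs') (mulWeight V hV hc (-s') s) ((memLp_one_weight hs').toLp _)
      (integralFun hs) 0 (u, c) = 0) : u = 0 ∧ c = 0 := by
  obtain ⟨a, ha⟩ := exists_support_bound hc
  obtain ⟨h0, hu⟩ := (blockOp_eq_zero_iff hs hs' hV hc ha u c).mp h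
  set c' : ℂ := c + ∫ y, fundSol (-y) * (V y * u y)
  set Ψ : ℝ → ℂ := fun x => c' + prim3 a (fun y => V y * u y) x with hΨ
  have hi : Integrable fun y => V y * u y := by
    simpa using integrable_limit_mul hV hc (g := fun _ => 1) continuous_const u
  have hΨc : Continuous Ψ := continuous_const.add (continuous_prim3 hi)
  have hVae : (fun y => V y * Ψ y) =ᵐ[volume] fun y => V y * u y := by
    filter_upwards [hu] with y hy
    rw [hy]
  have hz : Ψ = 0 := by
    by_contra hne
    exact hno ⟨Ψ, hne, isSolution_of_eq_const_add_prim3 hV hc ha hΨc (c := c')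
      (fun x => by rw [prim3_congr hVae]) (by rw [integral_congr_ae hVae, h0])⟩
  have hu0 : u = 0 := by
    refine ext_weight (hu.trans ?_)
    have hz' := coeFn_zero_weight (-s')
    refine EventuallyEq.trans ?_ hz'.symm
    exact Eventually.of_forall fun x => congrFun hz x
  refine ⟨hu0, ?_⟩
  rw [hu0, blockOp_apply, map_zero, map_zero, add_zero, zero_sub, Prod.mk_eq_zero, neg_eq_zero,
    smul_eq_zero] at h
  refine h.1.resolve_right fun hone => ?_
  have h1 := coeFn_toLp_weight (memLp_one_weight hs')
  rw [hone] at h1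
  have hz' := coeFn_zero_weight (-s')
  obtain ⟨x, hx, hx'⟩ := (h1.and hz').exists
  rw [hx'] at hx
  exact zero_ne_one hx

lemma HasBoundedSolution.exists_blockOp_eq_zero (hs : 3 / 2 < s) (hs' : 3 / 2 < s')
    (hV : Continuous V) (hc : HasCompactSupport V) (h : HasBoundedSolution V) :
    ∃ (u : L2w (-s')) (c : ℂ), u ≠ 0 ∧ blockOp (limOp hs hs') (mulWeight V hV hc (-s') s)
      ((memLp_one_weight hs').toLp _) (integralFun hs) 0 (u, c) = 0 := by
  obtain ⟨a, ha⟩ := exists_support_bound hc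
  obtain ⟨Ψ, hne, hsol, hb, hb'⟩ := h
  obtain ⟨⟨c, hrep⟩, h0⟩ := eq_const_add_prim3 hV hc ha hsol hb hb'
  have hΨc : Continuous Ψ := hsol.1.continuous
  obtain ⟨C, hC⟩ := hb
  have hm : MemLp Ψ 2 (weight (-s')) :=
    memLp_weight_neg_of_le (C := C) hs' hΨc.aestronglyMeasurable fun y => by
      have := hC y
      rwa [inv_mul_le_iff₀ (bracket_pos y), mul_comm] at this
  have hu := coeFn_toLp_weight hm
  have hVae : (fun y => V y * hm.toLp Ψ y) =ᵐ[volume] fun y => V y * Ψ y := by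
    filter_upwards [hu] with y hy
    rw [hy]
  refine ⟨hm.toLp Ψ, c - ∫ y, fundSol (-y) * (V y * hm.toLp Ψ y), fun hz => hne ?_,
    (blockOp_eq_zero_iff hs hs' hV hc ha _ _).mpr ⟨by rw [integral_congr_ae hVae, h0], ?_⟩⟩
  · rw [hz] at hu
    have hz' := coeFn_zero_weight (-s')
    exact (Continuous.ae_eq_iff_eq volume hΨc continuous_zero).mp (hu.symm.trans hz')
  · rw [sub_add_cancel, prim3_congr hVae]
    exact hu.trans (Eventually.of_forall hrep)

/-- The witness is ⟨y⟩^{-2s}. Such a φ is needed to tune the singular coefficient in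
`eq_zero_of_tendsto_resolvent`. -/
lemma exists_integralFun_ne_zero (hs : 3 / 2 < s) : ∃ φ : L2w s, integralFun hs φ ≠ 0 := by
  have hm : MemLp (dens s fun _ => 1) 2 (weight s) :=
    memLp_dens (C := 2) hs measurable_const norm_one_le
  refine ⟨hm.toLp _, ?_⟩
  rw [integralFun_apply, integral_congr_ae (coeFn_toLp_weight hm)]
  have e : ∀ y, dens s (fun _ => 1) y = ((bracket y ^ (-(2 * s)) : ℝ) : ℂ) := fun y => one_mul _
  simp only [e]
  rw [integral_complex_ofReal, Complex.ofReal_ne_zero]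
  refine ne_of_gt ?_
  have hi : Integrable fun y => bracket y ^ (-(2 * s)) := by
    have := (integrable_of_memLp_weight hs hm).norm
    refine this.congr (Eventually.of_forall fun y => ?_)
    simp only [norm_dens, norm_one, one_mul]
  exact integral_pos_of_integrable_nonneg_nonzero (x := 0) (continuous_bracket_rpow _) hi
    (fun y => Real.rpow_nonneg (bracket_pos y).le _) (Real.rpow_pos_of_pos (bracket_pos 0) _).ne'

end NullSpace

/-! ### The dichotomy -/

section Main

variable {s s' : ℝ} {V : ℝ → ℂ}

theorem resolventConverges_iff (hV : Continuous V) (hc : HasCompactSupport V) (hs : 3 / 2 < s)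
    (hs' : 3 / 2 < s') (h0 : 0 ≤ s) (h0' : 0 ≤ s') :
    ResolventConverges (perturbed V hV hc) h0 h0' ↔ ¬HasBoundedSolution V := by
  have hG := embOut_freeResExt_embIn hs hs' h0 h0'
  rw [perturbed, mulOp_eq_comp V hV hc h0 h0']
  constructor
  · rintro ⟨R', hR', L, hL⟩ hsol
    obtain ⟨u, c, hu, huc⟩ := hsol.exists_blockOp_eq_zero hs hs' hV hc
    obtain ⟨φ, hφ⟩ := exists_integralFun_ne_zero hs
    exact hu (eq_zero_of_tendsto_resolvent isResolvent_freeResExt eventually_kap_ne_zero hG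
      (tendsto_regOp hs hs') (tendsto_profExt_toLp hs') (tendsto_singFun hs) tendsto_kap_inv hφ
      hR' hL huc)
  · intro hno
    exact exists_tendsto_resolvent isResolvent_freeResExt eventually_kap_ne_zero hG
      (tendsto_regOp hs hs') (tendsto_profExt_toLp hs') (tendsto_singFun hs) tendsto_kap_inv
      ((isCompactOperator_limOp hs hs').comp_clm _)
      (eq_zero_of_blockOp_eq_zero hs hs' hV hc hno)

end Main

end CubicOperator

theorem theorem2 (V : ℝ → ℂ) (hV : Continuous V) (hc : HasCompactSupport V)
    (s s' : ℝ) (hs : 3 - 3 / 2 < s) (hs' : 3 - 3 / 2 < s') :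
    Xor
      (CubicOperator.ResolventConverges (CubicOperator.perturbed V hV hc)
        (s := s) (s' := s') (by linarith) (by linarith))
      (∃ Ψ : ℝ → ℂ, Ψ ≠ 0 ∧ CubicOperator.IsSolution V Ψ ∧
        (∃ C : ℝ, ∀ x : ℝ, (CubicOperator.bracket x)⁻¹ * ‖Ψ x‖ ≤ C) ∧
        (∃ C : ℝ, ∀ x : ℝ, x ≤ 0 → ‖Ψ x‖ ≤ C)) := by
  have h := CubicOperator.resolventConverges_iff hV hc (s := s) (s' := s') (by linarith)
    (by linarith) (by linarith) (by linarith)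
  by_cases hsol : CubicOperator.HasBoundedSolution V
  · exact Or.inr ⟨hsol, fun hR => h.mp hR hsol⟩
  · exact Or.inl ⟨h.mpr hsol, hsol⟩
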